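/- A \emph{weighted transition system} (WTS) is a three-sorted structure $\mathfrak S=\langle S,P,A,\delta,+\rangle$, where $S$ (configurations) and $A$ (actions) are countable sets, $P$ is a countable set of nonnegative real numbers closed under addition, $+:P\times P\to P$ is addition, and $\delta:S\times A\times S\to P$. It has \emph{branching bound} $n$ if $|\{t\in S:\delta(s,a,t)\neq 0\}|\le n$ for all $s\in S$, $a\in A$. A binary relation $R\subseteq S\times S$ is a \emph{bisimulation} on $\mathfrak S$ if it is an equivalence relation and $(s,s')\in R$ implies $\sum_{t\in E}\delta(s,a,t)=\sum_{t\in E}\delta(s',a,t)$ for every action $a\in A$ and every equivalence class $E\in S/R$. Let $\mathfrak S_R$ denote the expansion of $\mathfrak S$ by $R$; first-order sentences are three-sorted and over the symbols $\delta,+,R$ and equality. The structure $\mathfrak S_R$ is \emph{regular} if there are bijections from $S$, $A$, $P$ onto regular languages over a finite alphabet under which the graph of $\delta$, the graph of $+$ and the relation $R$ become regular relations, that is, relations $Q\subseteq(\Sigma^*)^k$ whose language of convolutions $\{w_1\otimes\cdots\otimes w_k:(w_1,\dots,w_k)\in Q\}$ is regular, where $w_1\otimes\cdots\otimes w_k$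 is the word over $(\Sigma\uplus\{\#\})^k$ obtained by juxtaposing the $w_i$ and padding the shorter ones at the end with the blank $\#$. A \emph{regular presentation} of $\mathfrak S_R$ is given by finite automata for these three languages and three languages of convolutions. \textbf{Theorem.} There is a family of first-order sentences $(\Phi_n)_{n\in\mathbb N}$ such that: (1) for every $n$, every WTS $\mathfrak S$ with branching bound $n$ and every binary relation $R$ on its configurations, $R$ is a bisimulation on $\mathfrak S$ if and only if $\mathfrak S_R\models\Phi_n$; thus $\Phi_n$ depends only on the branching bound; (2) there is an algorithm (a total computable function) that, given $n$ and a regular presentation of $\mathfrak S_R$ for a WTS $\mathfrak S$ and a binary relation $R$, decides whether $\mathfrak S_R\models\Phi_n$. -/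

import Mathlib

open scoped NNReal ENNReal

/-! ### Weighted transition systems and bisimulations -/

/-- A weighted transition system `⟨S, P, A, δ, +⟩` with set of configurations `S`, set of actions
`A`, a set `P` of nonnegative real numbers that is closed under addition, and a weighted transition
function `δ : S × A × S → P`.  All three sets are countable. -/
structure WTS (S A : Type*) where
  P : AddSubsemigroup ℝ≥0
  δ : S → A → S → P
  countable_conf : Countable S
  countable_act : Countable A
  countable_weight : Countable P

namespace WTS

variable {S A : Type*} (𝔖 : WTS S A)

/-- `s →ₐ t`: the weight of the transition from `s` to `t` via action `a` is not zero. -/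
def Step (s : S) (a : A) (t : S) : Prop := (𝔖.δ s a t : ℝ≥0) ≠ 0

/-- Every configuration has at most `n` successors for every single action. -/
def BranchingBound (n : ℕ) : Prop := ∀ s a, {t | 𝔖.Step s a t}.encard ≤ n

/-- A bisimulation is an equivalence relation `R` such that related configurations give, for every
action, the same total weight to every equivalence class of `R`.  The sums are taken in `[0, ∞]`,
where they always exist. -/
def IsBisimulation (R : S → S → Prop) : Prop :=
  ∃ h : Equivalence R, ∀ s s', R s s' → ∀ a : A, ∀ E ∈ (Setoid.mk R h).classes,
    ∑' t : E, ((𝔖.δ s a t : ℝ≥0) : ℝ≥0∞) = ∑' t : E, ((𝔖.δ s' a t : ℝ≥0) : ℝ≥0∞)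

end WTS

/-! ### First-order logic over the three-sorted signature `(δ, +, R)`

Sorts: configurations, actions, weights.  Variables are de Bruijn indices, separately for each
sort; a newly bound variable gets index `0`. -/

/-- Terms of sort "weight" with `s` configuration variables, `a` action variables and `p` weight
variables.  Terms of the other two sorts are just variables. -/
inductive WeightTerm (s a p : ℕ) : Type
  | var (i : Fin p) : WeightTerm s a p
  | delta (i : Fin s) (k : Fin a) (j : Fin s) : WeightTerm s a p
  | add (x y : WeightTerm s a p) : WeightTerm s a p

/-- First-order formulas whose free variables are among `s` configuration variables, `a` action
variables and `p` weight variables. -/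
inductive WTSFormula : ℕ → ℕ → ℕ → Type
  | falsum {s a p : ℕ} : WTSFormula s a p
  | eqConf {s a p : ℕ} (i j : Fin s) : WTSFormula s a p
  | eqAct {s a p : ℕ} (i j : Fin a) : WTSFormula s a p
  | eqWeight {s a p : ℕ} (x y : WeightTerm s a p) : WTSFormula s a p
  | rel {s a p : ℕ} (i j : Fin s) : WTSFormula s a p
  | imp {s a p : ℕ} (φ ψ : WTSFormula s a p) : WTSFormula s a p
  | allConf {s a p : ℕ} (φ : WTSFormula (s + 1) a p) : WTSFormula s a p
  | allAct {s a p : ℕ} (φ : WTSFormula s (a + 1) p) : WTSFormula s a p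
  | allWeight {s a p : ℕ} (φ : WTSFormula s a (p + 1)) : WTSFormula s a p

/-- A sentence is a formula without free variables. -/
abbrev WTSSentence : Type := WTSFormula 0 0 0

namespace WTS

variable {S A : Type*} (𝔖 : WTS S A)

/-- The value of a term under an assignment of the variables. -/
def termValue {s a p : ℕ} (vS : Fin s → S) (vA : Fin a → A) (vP : Fin p → 𝔖.P) :
    WeightTerm s a p → 𝔖.P
  | .var i => vP i
  | .delta i k j => 𝔖.δ (vS i) (vA k) (vS j)
  | .add x y => termValue vS vA vP x + termValue vS vA vP y

/-- Satisfaction of a formula in the structure `𝔖_R`, the expansion of `𝔖` by the relation `R`,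
under an assignment of the variables. -/
def Realize (R : S → S → Prop) : {s a p : ℕ} → WTSFormula s a p →
    (Fin s → S) → (Fin a → A) → (Fin p → 𝔖.P) → Prop
  | _, _, _, .falsum, _, _, _ => False
  | _, _, _, .eqConf i j, vS, _, _ => vS i = vS j
  | _, _, _, .eqAct i j, _, vA, _ => vA i = vA j
  | _, _, _, .eqWeight x y, vS, vA, vP => 𝔖.termValue vS vA vP x = 𝔖.termValue vS vA vP y
  | _, _, _, .rel i j, vS, _, _ => R (vS i) (vS j)
  | _, _, _, .imp φ ψ, vS, vA, vP => Realize R φ vS vA vP → Realize R ψ vS vA vP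
  | _, _, _, .allConf φ, vS, vA, vP => ∀ x : S, Realize R φ (Fin.cons x vS) vA vP
  | _, _, _, .allAct φ, vS, vA, vP => ∀ x : A, Realize R φ vS (Fin.cons x vA) vP
  | _, _, _, .allWeight φ, vS, vA, vP => ∀ x : 𝔖.P, Realize R φ vS vA (Fin.cons x vP)

/-- `𝔖_R ⊨ Φ`. -/
def Models (R : S → S → Prop) (Φ : WTSSentence) : Prop :=
  𝔖.Realize R Φ Fin.elim0 Fin.elim0 Fin.elim0

end WTS

/-! ### Finite automata as finite data -/

/-- A nondeterministic finite automaton over letters from `α`, given by the lists of its initial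
states, of its transitions `(q, x, q')` and of its final states.  States are natural numbers.  Only
the finitely many letters on transitions can occur in accepted words, so that the accepted language
is a language over a finite alphabet. -/
structure FinAut (α : Type) where
  init : List ℕ
  trans : List (ℕ × α × ℕ)
  final : List ℕ

namespace FinAut

/-- An automaton is the triple of its three lists. -/
def equivProd (α : Type) : FinAut α ≃ List ℕ × List (ℕ × α × ℕ) × List ℕ where
  toFun M := (M.init, M.trans, M.final)
  invFun x := ⟨x.1, x.2.1, x.2.2⟩
  left_inv _ := rfl
  right_inv _ := rfl

instance (α : Type) [Primcodable α] : Primcodable (FinAut α) :=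
  Primcodable.ofEquiv _ (equivProd α)

/-- The language accepted by the automaton. -/
def language {α : Type} (M : FinAut α) : Language α :=
  NFA.accepts (σ := ℕ)
    { step := fun q x => {q' | (q, x, q') ∈ M.trans}
      start := {q | q ∈ M.init}
      accept := {q | q ∈ M.final} }

end FinAut

/-- The convolution `w₁ ⊗ ⋯ ⊗ wₖ` of `k` words over the letters `ℕ`: the word whose length is the
maximal length of the `wᵢ` and whose `j`-th letter is the tuple of the `j`-th letters of the `wᵢ`,
where the blank symbol `none` stands for letters beyond the end of a word. -/
def convolution {k : ℕ} (w : Fin k → List ℕ) : List (Fin k → Option ℕ) :=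
  (List.range (Finset.univ.sup fun i => (w i).length)).map fun j i => (w i)[j]?

/-- The automaton `M` recognizes the `k`-ary relation `R` on words: its language is the set of the
convolutions of the tuples in `R`. -/
def FinAut.Recognizes {k : ℕ} (M : FinAut (Fin k → Option ℕ)) (R : Set (Fin k → List ℕ)) : Prop :=
  M.language = convolution '' R

/-! ### Regular presentations -/

/-- The finite data of a regular presentation of a structure `𝔖_R`: automata for the three
universes, for the graph of `δ`, for the graph of addition and for `R`. -/
structure Presentation where
  conf : FinAut ℕ
  act : FinAut ℕ
  weight : FinAut ℕ
  delta : FinAut (Fin 4 → Option ℕ)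
  add : FinAut (Fin 3 → Option ℕ)
  rel : FinAut (Fin 2 → Option ℕ)

namespace Presentation

/-- A presentation is the tuple of its six automata. -/
def equivProd : Presentation ≃ FinAut ℕ × FinAut ℕ × FinAut ℕ × FinAut (Fin 4 → Option ℕ) ×
    FinAut (Fin 3 → Option ℕ) × FinAut (Fin 2 → Option ℕ) where
  toFun c := (c.conf, c.act, c.weight, c.delta, c.add, c.rel)
  invFun x := ⟨x.1, x.2.1, x.2.2.1, x.2.2.2.1, x.2.2.2.2.1, x.2.2.2.2.2⟩
  left_inv _ := rfl
  right_inv _ := rfl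

instance : Primcodable Presentation := Primcodable.ofEquiv _ equivProd

/-- `c` is a regular presentation of `𝔖_R`: there are bijections `eS`, `eA`, `eP` from the three
universes of `𝔖` onto the regular languages given by `c` that carry the graph of `δ`, the graph of
addition and the relation `R` to the relations recognized by the automata of `c`. -/
def Presents (c : Presentation) {S A : Type*} (𝔖 : WTS S A) (R : S → S → Prop) : Prop :=
  ∃ (eS : S → List ℕ) (eA : A → List ℕ) (eP : 𝔖.P → List ℕ),
    eS.Injective ∧ eA.Injective ∧ eP.Injective ∧
    Set.range eS = c.conf.language ∧
    Set.range eA = c.act.language ∧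
    Set.range eP = c.weight.language ∧
    c.delta.Recognizes {w | ∃ s a t, w = ![eS s, eA a, eS t, eP (𝔖.δ s a t)]} ∧
    c.add.Recognizes {w | ∃ p q, w = ![eP p, eP q, eP (p + q)]} ∧
    c.rel.Recognizes {w | ∃ s t, R s t ∧ w = ![eS s, eS t]}

end Presentation

/-! With at most `n` successors per action, the weight that `s` gives under `a` to the class of `u`
is a finite sum. A sentence can therefore guess `k ≤ n`, list exactly the successors of `s` in that
class and add up their weights. Since `P` need not contain `0`, a nonzero weight `x` is recognized
by `x + x ≠ x`, and the empty sum may lie outside `P`. Hence sums are compared after a shift: `s`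
and `s'` both lead from one weight `p` to the same `q`, and `p` cancels in `ℝ≥0`. This is
`IsBoundedBisimulation`; `BranchingBound.isBisimulation_iff` links it to bisimulations and
`models_boundedBisim` to the sentence.

For decidability, `BisimW` states the same condition about the words of a presentation. Instead of
constructing an automaton for it, `UnifReg` carries two facts through the logical operations: a
primitive recursive bound on the number of prefix classes (`NerodeLE`) and a primitive recursive
test. The language of an automaton has at most `2 ^ |states|` classes, negation keeps the bound,
conjunction multiplies the bounds, and projection is a subset construction
(`NerodeLE.exists_block`). The index in turn makes quantifiers searchable: by pumping, a witness may
be taken no longer than the parameters plus the index (`NerodeLE.exists_block_bounded`). All of this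
is uniform in `n` and the presentation, so the resulting test (`UnifReg.bisimW`) is a single
primitive recursive predicate. -/

/-! ### Relations of finite Nerode index on tuples of words

A tuple of words is an assignment `ℕ → List ℕ`.  A relation on tuples that is recognized by a
synchronous finite automaton depends on a prefix of the tuple only through finitely many classes. -/

/-- Component-wise concatenation of tuples of words. -/
def glue (u v : ℕ → List ℕ) : ℕ → List ℕ := fun m => u m ++ v m

/-- The tuple `u` is a prefix cut at position `i` which `v` continues. -/
def Fits (u : ℕ → List ℕ) (i : ℕ) (v : ℕ → List ℕ) : Prop :=
  ∀ m, (u m).length ≤ i ∧ (v m ≠ [] → (u m).length = i)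

/-- `Q` distinguishes at most `N` classes of prefixes. -/
def NerodeLE (N : ℕ) (Q : (ℕ → List ℕ) → Prop) : Prop :=
  ∃ f : (ℕ → List ℕ) → ℕ → Fin N, ∀ u u' i i' v, Fits u i v → Fits u' i' v →
    f u i = f u' i' → (Q (glue u v) ↔ Q (glue u' v))

/-- The tuple that starts with the first `k` words of `X` and goes on with `w`. -/
def blockEnv (k : ℕ) (X w : ℕ → List ℕ) : ℕ → List ℕ :=
  fun m => if m < k then X m else w (m - k)

theorem blockEnv_glue (k : ℕ) (X Y u v : ℕ → List ℕ) :
    blockEnv k (glue X Y) (glue u v) = glue (blockEnv k X u) (blockEnv k Y v) := by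
  funext m
  by_cases h : m < k <;> simp [blockEnv, glue, h]

theorem glue_take_drop (i : ℕ) (X : ℕ → List ℕ) :
    glue (fun m => (X m).take i) (fun m => (X m).drop i) = X := by
  funext m
  simp [glue]

namespace NerodeLE

/-- One implication suffices, as the hypothesis is symmetric in the two prefixes. -/
theorem of_finite {σ : Type} [Finite σ] {N : ℕ} {Q : (ℕ → List ℕ) → Prop}
    (f : (ℕ → List ℕ) → ℕ → σ) (hN : Nat.card σ ≤ N)
    (h : ∀ u u' i i' v, Fits u i v → Fits u' i' v → f u i = f u' i' →
      Q (glue u v) → Q (glue u' v)) : NerodeLE N Q := by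
  refine ⟨fun u i => Fin.castLE hN (Finite.equivFin σ (f u i)), ?_⟩
  intro u u' i i' v hu hu' he
  have he' : f u i = f u' i' := (Finite.equivFin σ).injective (Fin.castLE_injective hN he)
  exact ⟨h u u' i i' v hu hu' he', h u' u i' i v hu' hu he'.symm⟩

variable {N M : ℕ} {Q Q' : (ℕ → List ℕ) → Prop}

theorem const (p : Prop) : NerodeLE 1 (fun _ => p) :=
  ⟨fun _ _ => 0, fun _ _ _ _ _ _ _ _ => Iff.rfl⟩

theorem not (h : NerodeLE N Q) : NerodeLE N (fun w => ¬ Q w) := by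
  obtain ⟨f, hf⟩ := h
  exact ⟨f, fun u u' i i' v hu hu' he => not_congr (hf u u' i i' v hu hu' he)⟩

theorem and (h : NerodeLE N Q) (h' : NerodeLE M Q') :
    NerodeLE (N * M) (fun w => Q w ∧ Q' w) := by
  obtain ⟨f, hf⟩ := h
  obtain ⟨g, hg⟩ := h'
  refine of_finite (σ := Fin N × Fin M) (fun u i => (f u i, g u i)) (by simp) ?_
  intro u u' i i' v hu hu' he hq
  obtain ⟨h1, h2⟩ := Prod.mk.inj he
  exact ⟨(hf u u' i i' v hu hu' h1).1 hq.1, (hg u u' i i' v hu hu' h2).1 hq.2⟩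

theorem forall_lt {N : ℕ → ℕ} {Q : ℕ → (ℕ → List ℕ) → Prop} (h : ∀ j, NerodeLE (N j) (Q j))
    (m : ℕ) : NerodeLE (((List.range m).map N).prod) (fun w => ∀ j < m, Q j w) := by
  induction m with
  | zero => simpa using const True
  | succ m ih =>
    have := ih.and (h m)
    simpa only [List.range_succ, List.map_append, List.map_singleton, List.prod_append,
      List.prod_singleton, Nat.lt_succ_iff_lt_or_eq, or_imp, forall_and, forall_eq] using this

/-- Equality of two components. -/
theorem eq (a b : ℕ) : NerodeLE 2 (fun w => w a = w b) := by
  refine of_finite (σ := Prop) (fun u _ => u a = u b) (by simp) ?_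
  -- Nonempty continuations all start at position `i`, so an equality of glued words splits there.
  have key : ∀ u i v, Fits u i v → (glue u v a = glue u v b ↔ u a = u b ∧ v a = v b) := by
    intro u i v hu
    refine ⟨fun h => ?_, fun h => by simp [glue, h.1, h.2]⟩
    obtain ⟨ha, ha'⟩ := hu a
    obtain ⟨hb, hb'⟩ := hu b
    have hl := congrArg List.length h
    simp only [glue, List.length_append] at hl h
    by_cases hva : v a = []
    · by_cases hvb : v b = []
      · simpa [hva, hvb] using h
      · have := hb' hvb
        have := List.length_pos_iff.2 hvb
        simp only [hva, List.length_nil] at hl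
        omega
    · by_cases hvb : v b = []
      · have := ha' hva
        have := List.length_pos_iff.2 hva
        simp only [hvb, List.length_nil] at hl
        omega
      · exact List.append_inj h ((ha' hva).trans (hb' hvb).symm)
  intro u u' i i' v hu hu' he
  rw [key u i v hu, key u' i' v hu', he]
  exact id

/-- Subset construction: the class of `u` is the set of classes that `u` forms with all possible
prefixes of the witnesses. Each is recorded together with the witnesses that reach the cut, so that
a continuation of one guess also fits any other guess with the same record. -/
theorem exists_block (k : ℕ) (h : NerodeLE N Q) :
    NerodeLE (2 ^ (N * 2 ^ k)) (fun w => ∃ X, Q (blockEnv k X w)) := by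
  obtain ⟨f, hf⟩ := h
  refine of_finite (σ := Set (Fin N × (Fin k → Prop)))
    (fun u i => {x | ∃ X : ℕ → List ℕ, (∀ m, (X m).length ≤ i) ∧
      x = (f (blockEnv k X u) i, fun m : Fin k => (X m).length = i)})
    (by simp [Nat.card_eq_fintype_card]) ?_
  rintro u u' i i' v hu hu' he ⟨X, hX⟩
  have hmem : ((f (blockEnv k (fun m => (X m).take i) u) i,
      fun m : Fin k => ((X m).take i).length = i) : Fin N × (Fin k → Prop)) ∈
      {x | ∃ X : ℕ → List ℕ, (∀ m, (X m).length ≤ i) ∧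
        x = (f (blockEnv k X u) i, fun m : Fin k => (X m).length = i)} :=
    ⟨_, fun m => by simp, rfl⟩
  rw [show _ = _ from he] at hmem
  obtain ⟨Y, hY, hYe⟩ := hmem
  obtain ⟨h1, h2⟩ := Prod.mk.inj hYe
  refine ⟨glue Y (fun m => (X m).drop i), ?_⟩
  rw [blockEnv_glue]
  refine (hf _ _ i i' _ ?_ ?_ h1).1 ?_
  · intro m
    by_cases hm : m < k
    · simp only [blockEnv, hm, if_true, List.length_take, ne_eq, List.drop_eq_nil_iff]
      omega
    · simpa only [blockEnv, hm, if_false] using hu (m - k)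
  · intro m
    by_cases hm : m < k
    · simp only [blockEnv, hm, if_true, ne_eq, List.drop_eq_nil_iff]
      refine ⟨hY m, fun hd => ?_⟩
      have := congrFun h2 ⟨m, hm⟩
      simp only [List.length_take, eq_iff_iff] at this
      exact this.1 (by omega)
    · simpa only [blockEnv, hm, if_false] using hu' (m - k)
  · rw [← blockEnv_glue, glue_take_drop]
    exact hX

/-- Pumping: an existential quantifier over a block of words can be bounded. -/
theorem exists_block_bounded {k L : ℕ} (h : NerodeLE N Q) {w : ℕ → List ℕ}
    (hw : ∀ m, (w m).length ≤ L) {X : ℕ → List ℕ} (hX : Q (blockEnv k X w)) :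
    ∃ Y, (∀ m < k, (Y m).length ≤ L + N) ∧ Q (blockEnv k Y w) := by
  obtain ⟨f, hf⟩ := h
  induction hs : ∑ m ∈ Finset.range k, (X m).length using Nat.strong_induction_on
    generalizing X with
  | _ s ih =>
    by_cases hb : ∀ m < k, (X m).length ≤ L + N
    · exact ⟨X, hb, hX⟩
    push Not at hb
    obtain ⟨m₀, hm₀, hlong⟩ := hb
    -- Beyond `L` the parameters have ended. If the cuts at `i` and `j` have the same class,
    -- deleting the letters between them from every witness preserves `Q` and shortens the word
    -- `m₀`, so the induction on total length applies.
    have key : ∀ i j : ℕ, L ≤ i → i < j → j ≤ L + N →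
        f (blockEnv k (fun m => (X m).take i) w) i = f (blockEnv k (fun m => (X m).take j) w) j →
        ∃ Y, (∀ m < k, (Y m).length ≤ L + N) ∧ Q (blockEnv k Y w) := by
      intro i j hLi hij hj he
      have hfit : ∀ l ≤ j, L ≤ l → Fits (blockEnv k (fun m => (X m).take l) w) l
          (blockEnv k (fun m => (X m).drop j) (fun _ => [])) := by
        intro l hl hL m
        by_cases hm : m < k
        · simp only [blockEnv, hm, if_true, List.length_take, ne_eq, List.drop_eq_nil_iff]
          omega
        · simpa [blockEnv, hm] using (hw (m - k)).trans hL
      have hiff := hf _ _ i j _ (hfit i hij.le hLi) (hfit j le_rfl (hLi.trans hij.le)) he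
      have hnil : glue w (fun _ => []) = w := by funext m; simp [glue]
      rw [← blockEnv_glue, ← blockEnv_glue, hnil, glue_take_drop] at hiff
      refine ih _ ?_ (hiff.2 hX) rfl
      rw [← hs]
      refine Finset.sum_lt_sum (fun m _ => ?_) ⟨m₀, Finset.mem_range.2 hm₀, ?_⟩ <;>
      · simp only [glue, List.length_append, List.length_take, List.length_drop]
        omega
    -- Pigeonhole for the `N + 1` cuts `L, …, L + N`.
    obtain ⟨i, j, hij, he⟩ := Fintype.exists_ne_map_eq_of_card_lt
      (fun i : Fin (N + 1) => f (blockEnv k (fun m => (X m).take (L + i)) w) (L + i)) (by simp)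
    have hi := i.2
    have hj := j.2
    rcases lt_or_gt_of_ne (Fin.val_ne_of_ne hij) with hlt | hlt
    · exact key _ _ (by omega) (by omega) (by omega) he
    · exact key _ _ (by omega) (by omega) (by omega) he.symm

end NerodeLE

/-! ### Runs of automata as finite computations -/

namespace FinAut

variable {α : Type} [DecidableEq α]

/-- The states that are reached from a list of states by one letter. -/
def stepList (M : FinAut α) (S : List ℕ) (x : α) : List ℕ :=
  M.trans.flatMap fun t => if t.1 ∈ S ∧ t.2.1 = x then [t.2.2] else []

/-- The states that are reached from the initial states by a word. -/
def evalList (M : FinAut α) (w : List α) : List ℕ := w.foldl M.stepList M.init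

theorem mem_stepList {M : FinAut α} {S : List ℕ} {x : α} {q : ℕ} :
    q ∈ M.stepList S x ↔ ∃ r ∈ S, (r, x, q) ∈ M.trans := by
  simp only [stepList, List.mem_flatMap, Prod.exists]
  constructor
  · rintro ⟨r, y, q', ht, h⟩
    split_ifs at h with hc
    · obtain ⟨hr, hy⟩ := hc
      simp only [List.mem_singleton] at h
      subst h
      exact ⟨r, hr, hy ▸ ht⟩
    · simp at h
  · rintro ⟨r, hr, ht⟩
    exact ⟨r, x, q, ht, by simp [hr]⟩

theorem mem_language_iff {M : FinAut α} {w : List α} :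
    w ∈ M.language ↔ ∃ q ∈ M.evalList w, q ∈ M.final := by
  have key : ∀ (w : List α) (S : List ℕ),
      (NFA.evalFrom (σ := ℕ) { step := fun q x => {q' | (q, x, q') ∈ M.trans}
                               start := {q | q ∈ M.init}
                               accept := {q | q ∈ M.final} } {q | q ∈ S} w) =
        {q | q ∈ w.foldl M.stepList S} := by
    intro w
    induction w with
    | nil => intro S; rfl
    | cons x w ih =>
      intro S
      rw [NFA.evalFrom_cons, List.foldl_cons, ← ih]
      congr 1
      ext q
      simp [NFA.mem_stepSet, mem_stepList]
  rw [language, NFA.mem_accepts]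
  simp only [evalList]
  rw [key]
  simp only [Set.mem_ofPred_eq]
  exact ⟨fun ⟨q, h, h'⟩ => ⟨q, h', h⟩, fun ⟨q, h, h'⟩ => ⟨q, h', h⟩⟩

theorem evalList_append (M : FinAut α) (x y : List α) :
    M.evalList (x ++ y) = y.foldl M.stepList (M.evalList x) := List.foldl_append

/-- State lists may differ in order and multiplicity; monotonicity lets runs be compared through
their underlying sets only. -/
theorem foldl_stepList_mono (M : FinAut α) {S T : List ℕ} (h : S ⊆ T) (y : List α) :
    y.foldl M.stepList S ⊆ y.foldl M.stepList T := by
  induction y generalizing S T with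
  | nil => exact h
  | cons x y ih =>
    refine ih fun q hq => ?_
    rw [mem_stepList] at hq ⊢
    obtain ⟨r, hr, ht⟩ := hq
    exact ⟨r, h hr, ht⟩

/-- All states that can be reached. -/
def states (M : FinAut α) : List ℕ := M.init ++ M.trans.map fun t => t.2.2

theorem evalList_subset_states (M : FinAut α) (w : List α) : M.evalList w ⊆ M.states := by
  induction w using List.reverseRecOn with
  | nil => exact List.subset_append_left _ _
  | append_singleton w x _ =>
    intro q hq
    rw [evalList_append, List.foldl_cons, List.foldl_nil, mem_stepList] at hq
    obtain ⟨r, _, ht⟩ := hq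
    exact List.mem_append_right _ (List.mem_map.2 ⟨_, ht, rfl⟩)

/-- A relation that is tested by running an automaton on a word that depends on the tuple
synchronously. -/
theorem nerodeLE_language (M : FinAut α) (g : (ℕ → List ℕ) → List α)
    (hg : ∀ u i v, Fits u i v → g (glue u v) = g u ++ g v) :
    NerodeLE (2 ^ M.states.length) (fun w => g w ∈ M.language) := by
  -- The classes are the states of the powerset automaton.
  refine NerodeLE.of_finite (σ := M.states.toFinset.powerset)
    (fun u _ => ⟨(M.evalList (g u)).toFinset, ?_⟩) ?_ ?_
  · rw [Finset.mem_powerset]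
    intro q hq
    rw [List.mem_toFinset] at hq ⊢
    exact evalList_subset_states M _ hq
  · rw [Nat.card_eq_fintype_card, Fintype.card_coe, Finset.card_powerset]
    exact Nat.pow_le_pow_right (by norm_num) (List.toFinset_card_le _)
  · intro u u' i i' v hu hu' he hq
    have hs : (M.evalList (g u)).toFinset = (M.evalList (g u')).toFinset := Subtype.mk.inj he
    have hsub : M.evalList (g u) ⊆ M.evalList (g u') := fun q hq => by
      rwa [← List.mem_toFinset, ← hs, List.mem_toFinset]
    rw [mem_language_iff, hg u i v hu, evalList_append] at hq
    rw [mem_language_iff, hg u' i' v hu', evalList_append]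
    obtain ⟨q, h1, h2⟩ := hq
    exact ⟨q, M.foldl_stepList_mono hsub _ h1, h2⟩

/-- Needed to bound the alphabet: letters are arbitrary elements of `α`, but those of accepted words
can be read off the transitions. -/
theorem letter_of_mem_language {M : FinAut α} {w : List α} (hw : w ∈ M.language) {x : α}
    (hx : x ∈ w) : ∃ t ∈ M.trans, t.2.1 = x := by
  rw [mem_language_iff] at hw
  obtain ⟨q, hq, _⟩ := hw
  obtain ⟨y, z, rfl⟩ := List.append_of_mem hx
  rw [evalList_append, List.foldl_cons] at hq
  by_contra hne
  have hnil : M.stepList (M.evalList y) x = [] := by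
    rw [List.eq_nil_iff_forall_not_mem]
    intro r hr
    obtain ⟨r', _, ht⟩ := mem_stepList.1 hr
    exact hne ⟨_, ht, rfl⟩
  rw [hnil] at hq
  have : ∀ z : List α, z.foldl M.stepList [] = [] := by
    intro z
    induction z with
    | nil => rfl
    | cons a z ih =>
      have : M.stepList [] a = [] := by
        rw [List.eq_nil_iff_forall_not_mem]
        intro r hr
        obtain ⟨r', h, _⟩ := mem_stepList.1 hr
        simp at h
      rw [List.foldl_cons, this, ih]
  rw [this] at hq
  simp at hq

end FinAut

/-! ### Convolutions -/

theorem length_convolution {k : ℕ} (w : Fin k → List ℕ) :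
    (convolution w).length = Finset.univ.sup fun i => (w i).length := by
  simp [convolution]

theorem getElem?_convolution {k : ℕ} (w : Fin k → List ℕ) (j : ℕ) :
    (convolution w)[j]? = if j < Finset.univ.sup (fun i => (w i).length)
      then some (fun i => (w i)[j]?) else none := by
  simp only [convolution, List.getElem?_map]
  split_ifs <;> simp_all

theorem convolution_injective {k : ℕ} : Function.Injective (convolution (k := k)) := by
  intro w w' h
  funext i
  refine List.ext_getElem? fun j => ?_
  have hl := congrArg List.length h
  rw [length_convolution, length_convolution] at hl
  have hj := congrArg (·[j]?) h
  simp only [getElem?_convolution, ← hl] at hj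
  by_cases hlt : j < Finset.univ.sup (fun i => (w i).length)
  · rw [if_pos hlt, if_pos hlt] at hj
    exact congrFun (Option.some.inj hj) i
  · have h1 : (w i).length ≤ j :=
      (Finset.le_sup (f := fun i => (w i).length) (Finset.mem_univ i)).trans (not_lt.1 hlt)
    rw [hl] at hlt
    have h2 : (w' i).length ≤ j :=
      (Finset.le_sup (f := fun i => (w' i).length) (Finset.mem_univ i)).trans (not_lt.1 hlt)
    rw [List.getElem?_eq_none h1, List.getElem?_eq_none h2]

/-- No prefix passes `i`, and every word that continues does so exactly at `i`, so the padding lines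
up. An automaton on convolutions thus reads a tuple synchronously, as `nerodeLE_language` requires.
-/
theorem convolution_glue {k : ℕ} (ρ : Fin k → ℕ) {u v : ℕ → List ℕ} {i : ℕ} (h : Fits u i v) :
    convolution (fun m => glue u v (ρ m)) =
      convolution (fun m => u (ρ m)) ++ convolution (fun m => v (ρ m)) := by
  -- If no selected word continues, all prefixes may be shorter than `i`, and `hsup` below could
  -- fail.
  by_cases hv : ∀ m, v (ρ m) = []
  · simp [convolution, glue, hv]
  push Not at hv
  obtain ⟨m₀, hm₀⟩ := hv
  have hsup : (Finset.univ.sup fun m => (u (ρ m)).length) = i := by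
    refine le_antisymm (Finset.sup_le fun m _ => (h _).1) ?_
    rw [← (h (ρ m₀)).2 hm₀]
    exact Finset.le_sup (f := fun m => (u (ρ m)).length) (Finset.mem_univ m₀)
  have hsup' : (Finset.univ.sup fun m => (glue u v (ρ m)).length) =
      i + Finset.univ.sup fun m => (v (ρ m)).length := by
    refine le_antisymm (Finset.sup_le fun m _ => ?_) ?_
    · simp only [glue, List.length_append]
      exact Nat.add_le_add (h _).1
        (Finset.le_sup (f := fun m => (v (ρ m)).length) (Finset.mem_univ m))
    · obtain ⟨m₁, _, hm₁⟩ := Finset.exists_mem_eq_sup Finset.univ ⟨m₀, Finset.mem_univ _⟩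
        (fun m => (v (ρ m)).length)
      rw [hm₁]
      have hne : v (ρ m₁) ≠ [] := by
        intro h0
        have := Finset.le_sup (f := fun m => (v (ρ m)).length) (Finset.mem_univ m₀)
        rw [hm₁, h0] at this
        exact hm₀ (List.length_eq_zero_iff.1 (Nat.le_zero.1 this))
      rw [← (h (ρ m₁)).2 hne, ← List.length_append]
      exact Finset.le_sup (f := fun m => (glue u v (ρ m)).length) (Finset.mem_univ m₁)
  refine List.ext_getElem? fun j => ?_
  rw [List.getElem?_append, length_convolution, getElem?_convolution, getElem?_convolution,
    getElem?_convolution, hsup, hsup']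
  by_cases hj : j < i
  · rw [if_pos (by omega), if_pos hj, if_pos hj]
    congr 1
    funext m
    simp only [glue, List.getElem?_append]
    split_ifs with hlt
    · rfl
    · have : v (ρ m) = [] := by
        by_contra hne
        have := (h (ρ m)).2 hne
        omega
      simp [this, List.getElem?_eq_none (not_lt.1 hlt)]
  · rw [if_neg hj]
    by_cases hj' : j < i + Finset.univ.sup fun m => (v (ρ m)).length
    · rw [if_pos hj', if_pos (by omega)]
      congr 1
      funext m
      have := (h (ρ m)).1
      simp only [glue]
      rw [List.getElem?_append_right (by omega)]
      by_cases hne : v (ρ m) = []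
      · simp [hne]
      · rw [(h (ρ m)).2 hne]
    · rw [if_neg hj', if_neg (by omega)]

/-! ### Uniformly regular families of relations -/

namespace Primrec

theorem nat_pow : Primrec₂ ((· ^ ·) : ℕ → ℕ → ℕ) := Primrec₂.unpaired'.1 Nat.Primrec.pow

theorem nat_list_prod : Primrec (List.prod : List ℕ → ℕ) :=
  (Primrec.list_foldr Primrec.id (Primrec.const 1)
    (Primrec.nat_mul.comp (Primrec.fst.comp Primrec.snd)
      (Primrec.snd.comp Primrec.snd)).to₂).of_eq fun l => by simp [List.prod]

theorem nat_list_sum : Primrec (List.sum : List ℕ → ℕ) :=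
  (Primrec.list_foldr Primrec.id (Primrec.const 0)
    (Primrec.nat_add.comp (Primrec.fst.comp Primrec.snd)
      (Primrec.snd.comp Primrec.snd)).to₂).of_eq fun l => by simp [List.sum]

theorem list_mem {α : Type*} [Primcodable α] : PrimrecRel fun (a : α) (l : List α) => a ∈ l :=
  (PrimrecRel.exists_mem_list Primrec.eq).swap.of_eq fun a l => by simp [Function.swap]

end Primrec

/-- All lists of length `k` over the alphabet `W`. -/
def listsOfLength {α : Type*} (W : List α) (k : ℕ) : List (List α) :=
  Nat.rec [[]] (fun _ L => L.flatMap fun l => W.map fun x => x :: l) k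

theorem mem_listsOfLength {α : Type*} {W : List α} {k : ℕ} {l : List α} :
    l ∈ listsOfLength W k ↔ l.length = k ∧ ∀ x ∈ l, x ∈ W := by
  induction k generalizing l with
  | zero => simp +contextual [listsOfLength]
  | succ k ih =>
    have : listsOfLength W (k + 1) =
      (listsOfLength W k).flatMap fun l => W.map fun x => x :: l := rfl
    rw [this]
    cases l with
    | nil => simp
    | cons y l => simp [ih]; tauto

theorem primrec_listsOfLength {α : Type*} [Primcodable α] :
    Primrec₂ (listsOfLength : List α → ℕ → List (List α)) := by
  refine Primrec.nat_rec (Primrec.const [[]]) (Primrec.list_flatMap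
    (Primrec.snd.comp Primrec.snd) (Primrec.list_map (Primrec.fst.comp Primrec.fst)
      (Primrec.list_cons.comp Primrec.snd (Primrec.snd.comp Primrec.fst)).to₂).to₂).to₂

/-- All words of length at most `m` with letters below `K`. -/
def wordsUpTo (K m : ℕ) : List (List ℕ) :=
  (List.range (m + 1)).flatMap fun j => listsOfLength (List.range K) j

theorem mem_wordsUpTo {K m : ℕ} {w : List ℕ} :
    w ∈ wordsUpTo K m ↔ w.length ≤ m ∧ ∀ x ∈ w, x < K := by
  simp [wordsUpTo, mem_listsOfLength]

theorem primrec_wordsUpTo : Primrec₂ wordsUpTo :=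
  (Primrec.list_flatMap (Primrec.list_range.comp (Primrec.succ.comp Primrec.snd))
    (primrec_listsOfLength.comp (Primrec.list_range.comp (Primrec.fst.comp Primrec.fst))
      Primrec.snd).to₂).to₂

/-- The tuple of words that is given by a list. -/
def listEnv (l : List (List ℕ)) : ℕ → List ℕ := fun i => l.getD i []

theorem listEnv_append (B l : List (List ℕ)) :
    listEnv (B ++ l) = blockEnv B.length (listEnv B) (listEnv l) := by
  funext i
  by_cases h : i < B.length
  · simp only [listEnv, blockEnv, h, if_true]
    exact List.getD_append _ _ _ _ h
  · simp only [listEnv, blockEnv, h, if_false]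
    exact List.getD_append_right _ _ _ _ (not_lt.1 h)

theorem length_listEnv_le (l : List (List ℕ)) (i : ℕ) :
    (listEnv l i).length ≤ l.flatten.length := by
  by_cases h : i < l.length
  · rw [listEnv, List.getD_eq_getElem _ _ h]
    exact (List.sublist_flatten_of_mem (List.getElem_mem h)).length_le
  · rw [listEnv, List.getD_eq_default _ _ (not_lt.1 h)]
    exact Nat.zero_le _

/-- A family of relations on tuples of words whose Nerode index is bounded by a primitive recursive
function, and whose members can be tested by a primitive recursive function. -/
structure UnifReg {β : Type} [Primcodable β] (Q : β → (ℕ → List ℕ) → Prop) : Prop where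
  bound : ∃ N : β → ℕ, Primrec N ∧ ∀ b, NerodeLE (N b) (Q b)
  test : PrimrecPred fun x : β × List (List ℕ) => Q x.1 (listEnv x.2)

namespace UnifReg

variable {β : Type} [Primcodable β] {Q Q' : β → (ℕ → List ℕ) → Prop}

theorem of_iff (h : UnifReg Q) (he : ∀ b w, Q' b w ↔ Q b w) : UnifReg Q' := by
  have : Q' = Q := by
    funext b w
    exact propext (he b w)
  rwa [this]

theorem not (h : UnifReg Q) : UnifReg fun b w => ¬ Q b w := by
  obtain ⟨⟨N, hN, hQ⟩, ht⟩ := h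
  exact ⟨⟨N, hN, fun b => (hQ b).not⟩, ht.not⟩

theorem and (h : UnifReg Q) (h' : UnifReg Q') : UnifReg fun b w => Q b w ∧ Q' b w := by
  obtain ⟨⟨N, hN, hQ⟩, ht⟩ := h
  obtain ⟨⟨N', hN', hQ'⟩, ht'⟩ := h'
  exact ⟨⟨_, Primrec.nat_mul.comp hN hN', fun b => (hQ b).and (hQ' b)⟩, ht.and ht'⟩

theorem imp (h : UnifReg Q) (h' : UnifReg Q') : UnifReg fun b w => Q b w → Q' b w :=
  (h.and h'.not).not.of_iff fun b w => by tauto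

theorem iff (h : UnifReg Q) (h' : UnifReg Q') : UnifReg fun b w => (Q b w ↔ Q' b w) :=
  ((h.imp h').and (h'.imp h)).of_iff fun b w => by tauto

theorem forall_lt {m : β → ℕ} {P : β → ℕ → (ℕ → List ℕ) → Prop} (hm : Primrec m)
    (h : UnifReg fun x : β × ℕ => P x.1 x.2) : UnifReg fun b w => ∀ j < m b, P b j w := by
  obtain ⟨⟨N, hN, hQ⟩, ht⟩ := h
  refine ⟨⟨fun b => ((List.range (m b)).map fun j => N (b, j)).prod, ?_, fun b =>
    NerodeLE.forall_lt (fun j => hQ (b, j)) (m b)⟩, ?_⟩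
  · exact Primrec.nat_list_prod.comp (Primrec.list_map (Primrec.list_range.comp hm) hN.to₂)
  · have : PrimrecRel fun (j : ℕ) (x : β × List (List ℕ)) => P x.1 j (listEnv x.2) :=
      ht.comp (f := fun y : ℕ × (β × List (List ℕ)) => ((y.2.1, y.1), y.2.2))
        (Primrec.pair (Primrec.pair (Primrec.fst.comp Primrec.snd) Primrec.fst)
          (Primrec.snd.comp Primrec.snd))
    exact (this.forall_mem_list.comp (Primrec.list_range.comp (hm.comp Primrec.fst))
      Primrec.id).of_eq fun x => by simp

theorem exists_lt {m : β → ℕ} {P : β → ℕ → (ℕ → List ℕ) → Prop} (hm : Primrec m)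
    (h : UnifReg fun x : β × ℕ => P x.1 x.2) : UnifReg fun b w => ∃ j < m b, P b j w :=
  (forall_lt (P := fun b j w => ¬ P b j w) hm h.not).not.of_iff fun b w => by push Not; rfl

/-- The pumping bound on lengths and the letter bound `K` confine the witnesses to a computable
finite list. The total length of the parameters serves as the `L` of the pumping lemma. -/
theorem exists_blockEnv {k K : β → ℕ} (hk : Primrec k) (hK : Primrec K) (h : UnifReg Q)
    (hlet : ∀ b w, Q b w → ∀ i < k b, ∀ x ∈ w i, x < K b) :
    UnifReg fun b w => ∃ X, Q b (blockEnv (k b) X w) := by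
  obtain ⟨⟨N, hN, hQ⟩, ht⟩ := h
  refine ⟨⟨fun b => 2 ^ (N b * 2 ^ k b), Primrec.nat_pow.comp (Primrec.const 2)
    (Primrec.nat_mul.comp hN (Primrec.nat_pow.comp (Primrec.const 2) hk)),
    fun b => (hQ b).exists_block (k b)⟩, ?_⟩
  have hr : PrimrecRel fun (B : List (List ℕ)) (x : β × List (List ℕ)) =>
      Q x.1 (listEnv (B ++ x.2)) :=
    ht.comp (f := fun y : List (List ℕ) × (β × List (List ℕ)) => (y.2.1, y.1 ++ y.2.2))
      (Primrec.pair (Primrec.fst.comp Primrec.snd)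
        (Primrec.list_append.comp Primrec.fst (Primrec.snd.comp Primrec.snd)))
  have hs : Primrec fun x : β × List (List ℕ) =>
      listsOfLength (wordsUpTo (K x.1) (x.2.flatten.length + N x.1)) (k x.1) :=
    primrec_listsOfLength.comp (primrec_wordsUpTo.comp (hK.comp Primrec.fst)
      (Primrec.nat_add.comp (Primrec.list_length.comp (Primrec.list_flatten.comp Primrec.snd))
        (hN.comp Primrec.fst))) (hk.comp Primrec.fst)
  refine (hr.exists_mem_list.comp hs Primrec.id).of_eq fun x => ?_
  obtain ⟨b, l⟩ := x
  simp only [mem_listsOfLength, mem_wordsUpTo]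
  constructor
  · rintro ⟨B, ⟨hB, _⟩, hq⟩
    refine ⟨listEnv B, ?_⟩
    simpa [← hB, ← listEnv_append] using hq
  · rintro ⟨X, hX⟩
    obtain ⟨Y, hY, hq⟩ := (hQ b).exists_block_bounded (length_listEnv_le l) hX
    have hlen : ((List.range (k b)).map Y).length = k b := by simp
    have hYe : blockEnv (k b) (listEnv ((List.range (k b)).map Y)) (listEnv l) =
        blockEnv (k b) Y (listEnv l) := by
      funext i
      by_cases hi : i < k b <;> simp [blockEnv, hi, listEnv]
    refine ⟨(List.range (k b)).map Y, ⟨hlen, ?_⟩, ?_⟩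
    · intro w hw
      obtain ⟨i, hi, rfl⟩ := List.mem_map.1 hw
      rw [List.mem_range] at hi
      refine ⟨hY i hi, fun y hy => ?_⟩
      refine hlet b _ hq i hi y ?_
      simpa [blockEnv, hi] using hy
    · rw [listEnv_append, hlen]
      exact hYe ▸ hq

/-- Quantification over a block of words of which only the first `k b` matter. -/
theorem exists_words {k K : β → ℕ} {P : β → (ℕ → List ℕ) → (ℕ → List ℕ) → Prop}
    (hk : Primrec k) (hK : Primrec K)
    (h : UnifReg fun b w => P b w fun i => w (i + k b))
    (hloc : ∀ b X X' w, (∀ i < k b, X i = X' i) → P b X w → P b X' w)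
    (hlet : ∀ b X w, P b X w → ∀ i < k b, ∀ x ∈ X i, x < K b) :
    UnifReg fun b w => ∃ X, P b X w := by
  refine (exists_blockEnv hk hK h fun b w hP => hlet b _ _ hP).of_iff fun b w => ?_
  have hw : ∀ X : ℕ → List ℕ, (fun i => blockEnv (k b) X w (i + k b)) = w := by
    intro X
    funext i
    simp [blockEnv]
  simp only [hw]
  refine exists_congr fun X => ⟨hloc b _ _ w ?_, hloc b _ _ w ?_⟩ <;>
  · intro i hi
    simp [blockEnv, hi]

theorem exists_word {K : β → ℕ} {P : β → List ℕ → (ℕ → List ℕ) → Prop} (hK : Primrec K)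
    (h : UnifReg fun b w => P b (w 0) fun i => w (i + 1))
    (hlet : ∀ b x w, P b x w → ∀ y ∈ x, y < K b) : UnifReg fun b w => ∃ x, P b x w := by
  refine (exists_words (k := fun _ => 1) (P := fun b X w => P b (X 0) w) (Primrec.const 1) hK h
    ?_ ?_).of_iff fun b w => ⟨fun ⟨x, hx⟩ => ⟨fun _ => x, hx⟩, fun ⟨X, hX⟩ => ⟨X 0, hX⟩⟩
  · intro b X X' w hX
    simp only [hX 0 zero_lt_one, imp_self]
  · intro b X w hP i hi
    obtain rfl : i = 0 := by omega
    exact hlet b _ w hP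

/-- The guard `D` bounds the letters; an unguarded quantifier would range over an infinite alphabet.
-/
theorem forall_word {K : β → ℕ} {D : β → List ℕ → Prop}
    {P : β → List ℕ → (ℕ → List ℕ) → Prop} (hK : Primrec K)
    (hD : UnifReg fun b w => D b (w 0)) (h : UnifReg fun b w => P b (w 0) fun i => w (i + 1))
    (hlet : ∀ b x, D b x → ∀ y ∈ x, y < K b) : UnifReg fun b w => ∀ x, D b x → P b x w :=
  (exists_word (P := fun b x w => D b x ∧ ¬ P b x w) hK (hD.and h.not)
    fun b x _ hx => hlet b x hx.1).not.of_iff fun b w => by push Not; rfl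

theorem eq {i j : β → ℕ} (hi : Primrec i) (hj : Primrec j) :
    UnifReg fun b w => w (i b) = w (j b) := by
  refine ⟨⟨fun _ => 2, Primrec.const 2, fun b => NerodeLE.eq (i b) (j b)⟩, ?_⟩
  exact Primrec.eq.comp ((Primrec.list_getD []).comp Primrec.snd (hi.comp Primrec.fst))
    ((Primrec.list_getD []).comp Primrec.snd (hj.comp Primrec.fst))

end UnifReg

/-! ### Primitive recursive simulation of automata -/

namespace FinAut

variable {α : Type} [Primcodable α]

theorem primrec_init : Primrec (FinAut.init : FinAut α → List ℕ) :=
  Primrec.fst.comp (Primrec.of_equiv (e := equivProd α))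

theorem primrec_trans : Primrec (FinAut.trans : FinAut α → List (ℕ × α × ℕ)) :=
  Primrec.fst.comp (Primrec.snd.comp (Primrec.of_equiv (e := equivProd α)))

theorem primrec_final : Primrec (FinAut.final : FinAut α → List ℕ) :=
  Primrec.snd.comp (Primrec.snd.comp (Primrec.of_equiv (e := equivProd α)))

theorem primrec_states : Primrec (FinAut.states : FinAut α → List ℕ) :=
  Primrec.list_append.comp primrec_init
    (Primrec.list_map primrec_trans (Primrec.snd.comp (Primrec.snd.comp Primrec.snd)).to₂)

variable [DecidableEq α]

theorem primrec_stepList : Primrec fun x : FinAut α × List ℕ × α => x.1.stepList x.2.1 x.2.2 := by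
  refine Primrec.list_flatMap (primrec_trans.comp Primrec.fst) (Primrec₂.mk (Primrec.ite
    (PrimrecPred.and ?_ ?_) ?_ (Primrec.const [])))
  · exact Primrec.list_mem.comp (Primrec.fst.comp Primrec.snd)
      (Primrec.fst.comp (Primrec.snd.comp Primrec.fst))
  · exact Primrec.eq.comp (Primrec.fst.comp (Primrec.snd.comp Primrec.snd))
      (Primrec.snd.comp (Primrec.snd.comp Primrec.fst))
  · exact Primrec.list_cons.comp (Primrec.snd.comp (Primrec.snd.comp Primrec.snd))
      (Primrec.const [])

theorem primrec_evalList : Primrec₂ (FinAut.evalList : FinAut α → List α → List ℕ) :=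
  Primrec.list_foldl Primrec.snd (primrec_init.comp Primrec.fst)
    (primrec_stepList.comp (Primrec.pair (Primrec.fst.comp Primrec.fst) Primrec.snd)).to₂

theorem primrecRel_mem_language :
    PrimrecRel fun (M : FinAut α) (w : List α) => w ∈ M.language := by
  have : PrimrecRel fun (q : ℕ) (M : FinAut α) => q ∈ M.final :=
    Primrec.list_mem.comp Primrec.fst (primrec_final.comp Primrec.snd)
  exact (this.exists_mem_list.comp primrec_evalList Primrec.fst).of_eq
    fun _ => mem_language_iff.symm

theorem unifReg_language {β : Type} [Primcodable β] {M : β → FinAut α}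
    {g : β → (ℕ → List ℕ) → List α} (hM : Primrec M)
    (hg : Primrec fun x : β × List (List ℕ) => g x.1 (listEnv x.2))
    (hglue : ∀ b u i v, Fits u i v → g b (glue u v) = g b u ++ g b v) :
    UnifReg fun b w => g b w ∈ (M b).language :=
  ⟨⟨fun b => 2 ^ (M b).states.length, Primrec.nat_pow.comp (Primrec.const 2)
    (Primrec.list_length.comp (primrec_states.comp hM)),
    fun b => (M b).nerodeLE_language (g b) (hglue b)⟩,
    primrecRel_mem_language.comp (hM.comp Primrec.fst) hg⟩

theorem unifReg_mem {β : Type} [Primcodable β] {M : β → FinAut ℕ} {i : β → ℕ}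
    (hM : Primrec M) (hi : Primrec i) : UnifReg fun b w => w (i b) ∈ (M b).language :=
  unifReg_language (g := fun b w => w (i b)) hM
    ((Primrec.list_getD []).comp Primrec.snd (hi.comp Primrec.fst)) fun _ _ _ _ _ => rfl

end FinAut

theorem primrec_convolution {k : ℕ} {γ : Type} [Primcodable γ] {w : γ → Fin k → List ℕ}
    (hw : ∀ i, Primrec fun x => w x i) : Primrec fun x => convolution (w x) := by
  have hsup : ∀ s : Finset (Fin k), Primrec fun x => s.sup fun i => (w x i).length := by
    intro s
    induction s using Finset.induction_on with
    | empty => simpa using Primrec.const 0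
    | insert i s _ ih =>
      simp only [Finset.sup_insert]
      exact Primrec.nat_max.comp (Primrec.list_length.comp (hw i)) ih
  refine Primrec.list_map (Primrec.list_range.comp (hsup _)) ?_
  refine Primrec.fin_curry.2 (Primrec.fin_curry₁ (f := fun i (y : γ × ℕ) => (w y.1 i)[y.2]?).2 ?_).swap
  exact fun i => Primrec.list_getElem?.comp ((hw i).comp Primrec.fst) Primrec.snd

theorem FinAut.unifReg_convolution {k : ℕ} {β : Type} [Primcodable β]
    {M : β → FinAut (Fin k → Option ℕ)} {ρ : β → Fin k → ℕ} (hM : Primrec M)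
    (hρ : ∀ i, Primrec fun b => ρ b i) :
    UnifReg fun b w => convolution (fun i => w (ρ b i)) ∈ (M b).language :=
  FinAut.unifReg_language (g := fun b w => convolution fun i => w (ρ b i)) hM
    (primrec_convolution fun i => (Primrec.list_getD []).comp Primrec.snd ((hρ i).comp Primrec.fst))
    fun b _ _ _ h => convolution_glue (ρ b) h

/-! ### The sentences on the level of words -/

namespace Presentation

/-- `δ(s, a, t) = p` on words. -/
def DeltaW (c : Presentation) (s a t p : List ℕ) : Prop :=
  convolution ![s, a, t, p] ∈ c.delta.language

/-- `p + q = r` on words. -/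
def AddW (c : Presentation) (p q r : List ℕ) : Prop := convolution ![p, q, r] ∈ c.add.language

/-- The relation `R` on words. -/
def RelW (c : Presentation) (s t : List ℕ) : Prop := convolution ![s, t] ∈ c.rel.language

/-- `δ(s, a, t) ≠ 0` on words. -/
def StepW (c : Presentation) (s a t : List ℕ) : Prop :=
  ∃ p, p ∈ c.weight.language ∧ c.DeltaW s a t p ∧ ¬ c.AddW p p p

/-- The words `X 0, …, X (k - 1)` are the successors of `s` under `a` that are related to `u`,
without repetition, and `X k, …, X (k + k)` are the partial sums of `p` and their weights; the
total sum is `q`. -/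
def ChainW (c : Presentation) (k : ℕ) (s a u p q : List ℕ) (X : ℕ → List ℕ) : Prop :=
  (∀ i < k, X i ∈ c.conf.language) ∧ (∀ i < k + 1, X (k + i) ∈ c.weight.language) ∧
    (∀ i < k, ∀ j < i, X i ≠ X j) ∧
    (∀ x, x ∈ c.conf.language → (c.RelW u x ∧ c.StepW s a x ↔ ∃ i < k, X i = x)) ∧
    X k = p ∧ X (k + k) = q ∧
    ∀ i < k, ∃ r, r ∈ c.weight.language ∧ c.DeltaW s a (X i) r ∧ c.AddW (X (k + i)) r (X (k + i + 1))

/-- Word version of the statement that `R` is an equivalence relation and that related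
configurations give the same weight, with at most `n` summands, to every class. -/
def BisimW (n : ℕ) (c : Presentation) : Prop :=
  (∀ s, s ∈ c.conf.language → c.RelW s s) ∧
  (∀ s, s ∈ c.conf.language → ∀ t, t ∈ c.conf.language → c.RelW s t → c.RelW t s) ∧
  (∀ s, s ∈ c.conf.language → ∀ t, t ∈ c.conf.language → ∀ u, u ∈ c.conf.language →
    c.RelW s t → c.RelW t u → c.RelW s u) ∧
  ∀ s, s ∈ c.conf.language → ∀ s', s' ∈ c.conf.language → ∀ a, a ∈ c.act.language →
    ∀ u, u ∈ c.conf.language → c.RelW s s' →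
      ∃ p, p ∈ c.weight.language ∧ ∃ q, q ∈ c.weight.language ∧
        (∃ k < n + 1, ∃ X, c.ChainW k s a u p q X) ∧ ∃ k < n + 1, ∃ X, c.ChainW k s' a u p q X

/-- A strict bound for the letters in the words of the three universes. -/
def letterBound (c : Presentation) : ℕ :=
  ((c.conf.trans ++ c.act.trans ++ c.weight.trans).map fun t => t.2.1).sum + 1

theorem lt_letterBound {c : Presentation} {x : List ℕ}
    (hx : x ∈ c.conf.language ∨ x ∈ c.act.language ∨ x ∈ c.weight.language) {y : ℕ} (hy : y ∈ x) :
    y < c.letterBound := by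
  have : y ∈ (c.conf.trans ++ c.act.trans ++ c.weight.trans).map fun t => t.2.1 := by
    rw [List.mem_map]
    rcases hx with hx | hx | hx <;>
    · obtain ⟨t, ht, rfl⟩ := FinAut.letter_of_mem_language hx hy
      exact ⟨t, by simp [ht], rfl⟩
  exact Nat.lt_succ_of_le (List.le_sum_of_mem this)

theorem primrec_equivProd : Primrec equivProd := Primrec.of_equiv

theorem primrec_conf : Primrec Presentation.conf := Primrec.fst.comp primrec_equivProd

theorem primrec_act : Primrec Presentation.act :=
  Primrec.fst.comp (Primrec.snd.comp primrec_equivProd)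

theorem primrec_weight : Primrec Presentation.weight :=
  Primrec.fst.comp (Primrec.snd.comp (Primrec.snd.comp primrec_equivProd))

theorem primrec_delta : Primrec Presentation.delta :=
  Primrec.fst.comp (Primrec.snd.comp (Primrec.snd.comp (Primrec.snd.comp primrec_equivProd)))

theorem primrec_add : Primrec Presentation.add :=
  Primrec.fst.comp (Primrec.snd.comp (Primrec.snd.comp (Primrec.snd.comp
    (Primrec.snd.comp primrec_equivProd))))

theorem primrec_rel : Primrec Presentation.rel :=
  Primrec.snd.comp (Primrec.snd.comp (Primrec.snd.comp (Primrec.snd.comp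
    (Primrec.snd.comp primrec_equivProd))))

theorem primrec_letterBound : Primrec letterBound :=
  Primrec.succ.comp (Primrec.nat_list_sum.comp (Primrec.list_map
    (Primrec.list_append.comp (Primrec.list_append.comp (FinAut.primrec_trans.comp primrec_conf)
      (FinAut.primrec_trans.comp primrec_act)) (FinAut.primrec_trans.comp primrec_weight))
    (Primrec.fst.comp (Primrec.snd.comp Primrec.snd)).to₂))

end Presentation

/-! ### Uniform regularity of the conditions on words -/

namespace UnifReg

open Presentation

variable {β : Type} [Primcodable β] {c : β → Presentation} {i k s a t u p q r : β → ℕ}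

theorem confW (hc : Primrec c) (hi : Primrec i) :
    UnifReg fun b w => w (i b) ∈ (c b).conf.language :=
  FinAut.unifReg_mem (M := fun b => (c b).conf) (primrec_conf.comp hc) hi

theorem actW (hc : Primrec c) (hi : Primrec i) :
    UnifReg fun b w => w (i b) ∈ (c b).act.language :=
  FinAut.unifReg_mem (M := fun b => (c b).act) (primrec_act.comp hc) hi

theorem weightW (hc : Primrec c) (hi : Primrec i) :
    UnifReg fun b w => w (i b) ∈ (c b).weight.language :=
  FinAut.unifReg_mem (M := fun b => (c b).weight) (primrec_weight.comp hc) hi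

theorem deltaW (hc : Primrec c) (hs : Primrec s) (ha : Primrec a) (ht : Primrec t)
    (hp : Primrec p) :
    UnifReg fun b w => (c b).DeltaW (w (s b)) (w (a b)) (w (t b)) (w (p b)) := by
  refine (FinAut.unifReg_convolution (M := fun b => (c b).delta)
    (ρ := fun b => ![s b, a b, t b, p b]) (primrec_delta.comp hc) ?_).of_iff fun b w => ?_
  · intro i
    fin_cases i <;> assumption
  · rw [DeltaW]
    convert Iff.rfl using 3
    funext i
    fin_cases i <;> rfl

theorem addW (hc : Primrec c) (hp : Primrec p) (hq : Primrec q) (hr : Primrec r) :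
    UnifReg fun b w => (c b).AddW (w (p b)) (w (q b)) (w (r b)) := by
  refine (FinAut.unifReg_convolution (M := fun b => (c b).add)
    (ρ := fun b => ![p b, q b, r b]) (primrec_add.comp hc) ?_).of_iff fun b w => ?_
  · intro i
    fin_cases i <;> assumption
  · rw [AddW]
    convert Iff.rfl using 3
    funext i
    fin_cases i <;> rfl

theorem relW (hc : Primrec c) (hs : Primrec s) (ht : Primrec t) :
    UnifReg fun b w => (c b).RelW (w (s b)) (w (t b)) := by
  refine (FinAut.unifReg_convolution (M := fun b => (c b).rel)
    (ρ := fun b => ![s b, t b]) (primrec_rel.comp hc) ?_).of_iff fun b w => ?_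
  · intro i
    fin_cases i <;> assumption
  · rw [RelW]
    convert Iff.rfl using 3
    funext i
    fin_cases i <;> rfl

theorem forall_conf {P : β → List ℕ → (ℕ → List ℕ) → Prop} (hc : Primrec c)
    (h : UnifReg fun b w => P b (w 0) fun i => w (i + 1)) :
    UnifReg fun b w => ∀ x, x ∈ (c b).conf.language → P b x w :=
  forall_word (primrec_letterBound.comp hc) (confW hc (Primrec.const 0)) h
    fun _ _ hx _ => lt_letterBound (.inl hx)

theorem forall_act {P : β → List ℕ → (ℕ → List ℕ) → Prop} (hc : Primrec c)
    (h : UnifReg fun b w => P b (w 0) fun i => w (i + 1)) :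
    UnifReg fun b w => ∀ x, x ∈ (c b).act.language → P b x w :=
  forall_word (primrec_letterBound.comp hc) (actW hc (Primrec.const 0)) h
    fun _ _ hx _ => lt_letterBound (.inr (.inl hx))

theorem exists_weight {P : β → List ℕ → (ℕ → List ℕ) → Prop} (hc : Primrec c)
    (h : UnifReg fun b w => P b (w 0) fun i => w (i + 1)) :
    UnifReg fun b w => ∃ x, x ∈ (c b).weight.language ∧ P b x w :=
  exists_word (P := fun b x w => x ∈ (c b).weight.language ∧ P b x w)
    (primrec_letterBound.comp hc) ((weightW hc (Primrec.const 0)).and h)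
    fun _ _ _ hx _ => lt_letterBound (.inr (.inr hx.1))

theorem stepW (hc : Primrec c) (hs : Primrec s) (ha : Primrec a) (ht : Primrec t) :
    UnifReg fun b w => (c b).StepW (w (s b)) (w (a b)) (w (t b)) :=
  exists_weight (P := fun b p w =>
      (c b).DeltaW (w (s b)) (w (a b)) (w (t b)) p ∧ ¬ (c b).AddW p p p) hc
    ((deltaW (p := fun _ => 0) hc (Primrec.succ.comp hs) (Primrec.succ.comp ha)
      (Primrec.succ.comp ht) (Primrec.const 0)).and
      (addW (p := fun _ => 0) (q := fun _ => 0) (r := fun _ => 0) hc (Primrec.const 0)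
        (Primrec.const 0) (Primrec.const 0)).not)

/-- The chain is the beginning of the tuple `w` itself. Its length varies with `b`, so positions are
primitive recursive functions of `b`, and the conjunctions over `i < k b` rest on `forall_lt`. -/
theorem chainW (hc : Primrec c) (hk : Primrec k) (hs : Primrec s) (ha : Primrec a)
    (hu : Primrec u) (hp : Primrec p) (hq : Primrec q) :
    UnifReg fun b w =>
      (c b).ChainW (k b) (w (s b)) (w (a b)) (w (u b)) (w (p b)) (w (q b)) w := by
  have hc1 : Primrec fun x : β × ℕ => c x.1 := hc.comp Primrec.fst
  have hk1 : Primrec fun x : β × ℕ => k x.1 := hk.comp Primrec.fst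
  have hki : Primrec fun x : β × ℕ => k x.1 + x.2 := Primrec.nat_add.comp hk1 Primrec.snd
  refine and ?_ (and ?_ (and ?_ (and ?_ (and ?_ (and ?_ ?_)))))
  · exact forall_lt (P := fun b i w => w i ∈ (c b).conf.language) hk (confW hc1 Primrec.snd)
  · exact forall_lt (m := fun b => k b + 1) (P := fun b i w => w (k b + i) ∈ (c b).weight.language)
      (Primrec.succ.comp hk) (weightW hc1 hki)
  · refine forall_lt (P := fun b i w => ∀ j < i, w i ≠ w j) hk ?_
    refine forall_lt (β := β × ℕ) (m := fun x => x.2) (P := fun x j w => w x.2 ≠ w j)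
      Primrec.snd ?_
    exact (eq (β := (β × ℕ) × ℕ) (i := fun y => y.1.2) (j := fun y => y.2)
      (Primrec.snd.comp Primrec.fst) Primrec.snd).not
  · refine forall_conf (P := fun b x w => ((c b).RelW (w (u b)) x ∧
      (c b).StepW (w (s b)) (w (a b)) x ↔ ∃ i < k b, w i = x)) hc ?_
    refine ((relW (t := fun _ => 0) hc (Primrec.succ.comp hu) (Primrec.const 0)).and
      (stepW (t := fun _ => 0) hc (Primrec.succ.comp hs) (Primrec.succ.comp ha)
        (Primrec.const 0))).iff ?_
    refine exists_lt (P := fun b i w => w (i + 1) = w 0) hk ?_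
    exact eq (β := β × ℕ) (i := fun x => x.2 + 1) (j := fun _ => 0)
      (Primrec.succ.comp Primrec.snd) (Primrec.const 0)
  · exact eq hk hp
  · exact eq (i := fun b => k b + k b) (Primrec.nat_add.comp hk hk) hq
  · refine forall_lt (P := fun b i w => ∃ r, r ∈ (c b).weight.language ∧
      (c b).DeltaW (w (s b)) (w (a b)) (w i) r ∧ (c b).AddW (w (k b + i)) r (w (k b + i + 1)))
      hk ?_
    refine exists_weight (β := β × ℕ) (c := fun x => c x.1) (P := fun x r w =>
      (c x.1).DeltaW (w (s x.1)) (w (a x.1)) (w x.2) r ∧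
        (c x.1).AddW (w (k x.1 + x.2)) r (w (k x.1 + x.2 + 1))) hc1 ?_
    exact (deltaW (c := fun x : β × ℕ => c x.1) (s := fun x => s x.1 + 1) (a := fun x => a x.1 + 1)
      (t := fun x => x.2 + 1) (p := fun _ => 0) hc1 (Primrec.succ.comp (hs.comp Primrec.fst))
      (Primrec.succ.comp (ha.comp Primrec.fst)) (Primrec.succ.comp Primrec.snd)
      (Primrec.const 0)).and
      (addW (c := fun x : β × ℕ => c x.1) (p := fun x => k x.1 + x.2 + 1) (q := fun _ => 0)
        (r := fun x => k x.1 + x.2 + 1 + 1) hc1 (Primrec.succ.comp hki) (Primrec.const 0)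
        (Primrec.succ.comp (Primrec.succ.comp hki)))

theorem exists_chainW (hc : Primrec c) (hk : Primrec k) (hs : Primrec s) (ha : Primrec a)
    (hu : Primrec u) (hp : Primrec p) (hq : Primrec q) :
    UnifReg fun b w => ∃ X,
      (c b).ChainW (k b) (w (s b)) (w (a b)) (w (u b)) (w (p b)) (w (q b)) X := by
  have hm : Primrec fun b => k b + k b + 1 := Primrec.succ.comp (Primrec.nat_add.comp hk hk)
  refine exists_words (k := fun b => k b + k b + 1) (P := fun b X w =>
    (c b).ChainW (k b) (w (s b)) (w (a b)) (w (u b)) (w (p b)) (w (q b)) X) hm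
    (primrec_letterBound.comp hc) ?_ ?_ ?_
  -- The block of `k + k + 1` witnesses is put in front, which shifts every parameter by that
  -- amount.
  · exact chainW (s := fun b => s b + (k b + k b + 1)) (a := fun b => a b + (k b + k b + 1))
      (u := fun b => u b + (k b + k b + 1)) (p := fun b => p b + (k b + k b + 1))
      (q := fun b => q b + (k b + k b + 1)) hc hk (Primrec.nat_add.comp hs hm)
      (Primrec.nat_add.comp ha hm) (Primrec.nat_add.comp hu hm) (Primrec.nat_add.comp hp hm)
      (Primrec.nat_add.comp hq hm)
  · rintro b X X' w hX ⟨h1, h2, h3, h4, h5, h6, h7⟩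
    refine ⟨fun i hi => hX i (by omega) ▸ h1 i hi, fun i hi => hX (k b + i) (by omega) ▸ h2 i hi,
      fun i hi j hj => hX i (by omega) ▸ hX j (by omega) ▸ h3 i hi j hj, fun x hx => ?_,
      hX (k b) (by omega) ▸ h5, hX (k b + k b) (by omega) ▸ h6, fun i hi => ?_⟩
    · rw [h4 x hx]
      refine exists_congr fun i => and_congr_right fun hi => ?_
      rw [hX i (by omega)]
    · rw [← hX i (by omega), ← hX (k b + i) (by omega), ← hX (k b + i + 1) (by omega)]
      exact h7 i hi
  · rintro b X w ⟨h1, h2, -⟩ i hi y hy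
    by_cases hik : i < k b
    · exact lt_letterBound (.inl (h1 i hik)) hy
    · have := h2 (i - k b) (by omega)
      rw [Nat.add_sub_cancel' (not_lt.1 hik)] at this
      exact lt_letterBound (.inr (.inr this)) hy

theorem exists_lt_chainW {n : β → ℕ} (hn : Primrec n) (hc : Primrec c) (s a u p q : ℕ) :
    UnifReg fun b w => ∃ k < n b + 1, ∃ X, (c b).ChainW k (w s) (w a) (w u) (w p) (w q) X :=
  exists_lt (P := fun b k w => ∃ X, (c b).ChainW k (w s) (w a) (w u) (w p) (w q) X)
    (Primrec.succ.comp hn)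
    (exists_chainW (c := fun x : β × ℕ => c x.1) (k := fun x => x.2) (hc.comp Primrec.fst)
      Primrec.snd (Primrec.const s) (Primrec.const a) (Primrec.const u) (Primrec.const p)
      (Primrec.const q))

theorem bisimW : UnifReg fun (x : ℕ × Presentation) _ => BisimW x.1 x.2 := by
  have hc : Primrec fun x : ℕ × Presentation => x.2 := Primrec.snd
  have rel : ∀ i j : ℕ, UnifReg fun (x : ℕ × Presentation) w => x.2.RelW (w i) (w j) :=
    fun i j => relW hc (Primrec.const i) (Primrec.const j)
  refine and ?_ (and ?_ (and ?_ ?_))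
  · exact forall_conf hc (rel 0 0)
  · refine forall_conf hc (forall_conf hc ?_)
    exact (rel 1 0).imp (rel 0 1)
  · refine forall_conf hc (forall_conf hc (forall_conf hc ?_))
    exact (rel 2 1).imp ((rel 1 0).imp (rel 2 0))
  · refine forall_conf hc (forall_conf hc (forall_act hc (forall_conf hc ?_)))
    refine (rel 3 2).imp (exists_weight hc (exists_weight hc ?_))
    -- The bound words `s, s', a, u, p, q` now have positions `5, 4, 3, 2, 1, 0`.
    exact (exists_lt_chainW Primrec.fst hc 5 3 2 1 0).and
      (exists_lt_chainW Primrec.fst hc 4 3 2 1 0)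

end UnifReg

theorem Presentation.primrecPred_bisimW :
    PrimrecPred fun x : ℕ × Presentation => BisimW x.1 x.2 :=
  UnifReg.bisimW.test.comp (Primrec.pair Primrec.id (Primrec.const []))

/-! ### The bounded condition in a transition system -/

namespace WTS

variable {S A : Type*} (𝔖 : WTS S A)

/-- The class of `u` contains exactly `k` successors of `s` under `a`, and their weights add up to
the difference of `q` and `p`. -/
def SumIs (R : S → S → Prop) (k : ℕ) (s : S) (a : A) (u : S) (p q : 𝔖.P) : Prop :=
  ∃ t : Fin k → S, Function.Injective t ∧ (∀ x, (R u x ∧ 𝔖.Step s a x ↔ ∃ i, t i = x)) ∧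
    (q : ℝ≥0) = p + ∑ i, (𝔖.δ s a (t i) : ℝ≥0)

/-- `R` is an equivalence relation, and related configurations give the same total weight, with at
most `n` nonzero summands, to every class. -/
def IsBoundedBisimulation (n : ℕ) (R : S → S → Prop) : Prop :=
  (∀ s, R s s) ∧ (∀ s t, R s t → R t s) ∧ (∀ s t u, R s t → R t u → R s u) ∧
    ∀ s s' a u, R s s' → ∃ p q, (∃ k < n + 1, 𝔖.SumIs R k s a u p q) ∧
      ∃ k < n + 1, 𝔖.SumIs R k s' a u p q

/-- By cancellation `x + x = x` only for `x = 0`; the signature has no constant for zero. -/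
theorem step_iff {s : S} {a : A} {t : S} :
    𝔖.Step s a t ↔ 𝔖.δ s a t + 𝔖.δ s a t ≠ 𝔖.δ s a t := by
  rw [Step, ne_eq, ne_eq, ← Subtype.coe_inj, AddMemClass.coe_add, add_eq_left]

/-- The partial sums of `p` and the weights of the transitions from `s` to `t 0, t 1, …`. -/
def partialSum (s : S) (a : A) (t : ℕ → S) (p : 𝔖.P) (i : ℕ) : 𝔖.P :=
  Nat.rec p (fun j x => x + 𝔖.δ s a (t j)) i

theorem coe_partialSum (s : S) (a : A) (t : ℕ → S) (p : 𝔖.P) (i : ℕ) :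
    (𝔖.partialSum s a t p i : ℝ≥0) = p + ∑ j ∈ Finset.range i, (𝔖.δ s a (t j) : ℝ≥0) := by
  induction i with
  | zero => simp [partialSum]
  | succ i ih =>
    rw [Finset.sum_range_succ, ← add_assoc, ← ih]
    rfl

end WTS

/-! ### Correctness of the translation to words -/

namespace Presentation

variable {c : Presentation} {S A : Type*} {𝔖 : WTS S A} {R : S → S → Prop}
  {eS : S → List ℕ} {eA : A → List ℕ} {eP : 𝔖.P → List ℕ}

theorem deltaW_iff (hS : eS.Injective) (hA : eA.Injective) (hP : eP.Injective)
    (hδ : c.delta.Recognizes {w | ∃ s a t, w = ![eS s, eA a, eS t, eP (𝔖.δ s a t)]})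
    (s : S) (a : A) (t : S) (p : 𝔖.P) :
    c.DeltaW (eS s) (eA a) (eS t) (eP p) ↔ 𝔖.δ s a t = p := by
  rw [DeltaW, show c.delta.language = _ from hδ]
  refine (convolution_injective.mem_set_image).trans ⟨?_, ?_⟩
  · rintro ⟨s', a', t', h⟩
    have h0 := hS (congrFun h 0)
    have h1 := hA (congrFun h 1)
    have h2 := hS (congrFun h 2)
    have h3 := hP (congrFun h 3)
    subst h0 h1 h2
    exact h3.symm
  · rintro rfl
    exact ⟨s, a, t, rfl⟩

theorem addW_iff (hP : eP.Injective)
    (ha : c.add.Recognizes {w | ∃ p q, w = ![eP p, eP q, eP (p + q)]}) (p q r : 𝔖.P) :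
    c.AddW (eP p) (eP q) (eP r) ↔ p + q = r := by
  rw [AddW, show c.add.language = _ from ha]
  refine (convolution_injective.mem_set_image).trans ⟨?_, ?_⟩
  · rintro ⟨p', q', h⟩
    have h0 := hP (congrFun h 0)
    have h1 := hP (congrFun h 1)
    have h2 := hP (congrFun h 2)
    subst h0 h1
    exact h2.symm
  · rintro rfl
    exact ⟨p, q, rfl⟩

theorem relW_iff (hS : eS.Injective)
    (hR : c.rel.Recognizes {w | ∃ s t, R s t ∧ w = ![eS s, eS t]}) (s t : S) :
    c.RelW (eS s) (eS t) ↔ R s t := by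
  rw [RelW, show c.rel.language = _ from hR]
  refine (convolution_injective.mem_set_image).trans ⟨?_, ?_⟩
  · rintro ⟨s', t', hst, h⟩
    have h0 := hS (congrFun h 0)
    have h1 := hS (congrFun h 1)
    subst h0 h1
    exact hst
  · exact fun h => ⟨s, t, h, rfl⟩

/-- The words after the first `k` encode the successive partial sums, so a sum of variable length is
checked by the ternary addition relation alone. -/
theorem exists_chainW_iff (hS : eS.Injective) (hP : eP.Injective)
    (hSr : Set.range eS = c.conf.language) (hPr : Set.range eP = c.weight.language)
    (hδ : ∀ s a t p, c.DeltaW (eS s) (eA a) (eS t) (eP p) ↔ 𝔖.δ s a t = p)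
    (ha : ∀ p q r, c.AddW (eP p) (eP q) (eP r) ↔ p + q = r)
    (hR : ∀ s t, c.RelW (eS s) (eS t) ↔ R s t) (k : ℕ) (s : S) (a : A) (u : S) (p q : 𝔖.P) :
    (∃ X, c.ChainW k (eS s) (eA a) (eS u) (eP p) (eP q) X) ↔ 𝔖.SumIs R k s a u p q := by
  have conf_iff : ∀ x, x ∈ c.conf.language ↔ ∃ s, eS s = x := fun x => by
    rw [← hSr]; exact Iff.rfl
  have weight_iff : ∀ x, x ∈ c.weight.language ↔ ∃ p, eP p = x := fun x => by
    rw [← hPr]; exact Iff.rfl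
  have step : ∀ s a t, c.StepW (eS s) (eA a) (eS t) ↔ 𝔖.Step s a t := by
    intro s a t
    simp only [StepW, weight_iff, WTS.step_iff]
    constructor
    · rintro ⟨_, ⟨p, rfl⟩, h1, h2⟩
      rw [hδ] at h1
      rw [ha] at h2
      exact h1 ▸ h2
    · intro h
      exact ⟨_, ⟨𝔖.δ s a t, rfl⟩, (hδ _ _ _ _).2 rfl, fun h' => h ((ha _ _ _).1 h')⟩
  constructor
  · rintro ⟨X, h1, h2, h3, h4, h5, h6, h7⟩
    have ht : ∀ i, ∃ t, i < k → eS t = X i := by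
      intro i
      by_cases hi : i < k
      · obtain ⟨t, ht⟩ := (conf_iff _).1 (h1 i hi)
        exact ⟨t, fun _ => ht⟩
      -- For `i ≥ k` the value is arbitrary.
      · exact ⟨s, fun h => absurd h hi⟩
    choose t ht using ht
    refine ⟨fun i => t i, ?_, ?_, ?_⟩
    · intro i j hij
      have hX : X i = X j := by rw [← ht i i.2, ← ht j j.2]; exact congrArg eS hij
      by_contra hne
      rcases lt_or_gt_of_ne (Fin.val_ne_of_ne hne) with hlt | hlt
      · exact h3 j j.2 i hlt hX.symm
      · exact h3 i i.2 j hlt hX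
    · intro x
      have := h4 (eS x) ((conf_iff _).2 ⟨x, rfl⟩)
      rw [hR, step] at this
      rw [this]
      constructor
      · rintro ⟨i, hi, hx⟩
        exact ⟨⟨i, hi⟩, hS ((ht i hi).trans hx)⟩
      · rintro ⟨i, hx⟩
        exact ⟨i, i.2, by rw [← ht i i.2, ← hx]⟩
    · have hσ : ∀ i ≤ k, X (k + i) = eP (𝔖.partialSum s a t p i) := by
        intro i
        induction i with
        | zero => exact fun _ => h5
        | succ i ih =>
          intro hi
          obtain ⟨r, hr, hd, had⟩ := h7 i (by omega)
          obtain ⟨r, rfl⟩ := (weight_iff _).1 hr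
          -- The next word must be known to encode a weight before `had` can be read as an addition
          -- in `P`.
          obtain ⟨r', hr'⟩ := (weight_iff _).1 (h2 (i + 1) (by omega))
          rw [← ht i (by omega), hδ] at hd
          rw [ih (by omega), add_assoc k i 1, ← hr', ha] at had
          rw [← hr', ← had, ← hd]
          rfl
      have hq := hP (h6.symm.trans (hσ k le_rfl))
      rw [hq, WTS.coe_partialSum, Finset.sum_range]
  · rintro ⟨t, h1, h2, h3⟩
    let t' : ℕ → S := fun i => if h : i < k then t ⟨i, h⟩ else s
    have ht' : ∀ i (h : i < k), t' i = t ⟨i, h⟩ := fun i h => dif_pos h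
    let X : ℕ → List ℕ := fun i =>
      if i < k then eS (t' i) else eP (𝔖.partialSum s a t' p (i - k))
    have hX : ∀ i < k, X i = eS (t' i) := fun i h => if_pos h
    have hX' : ∀ i, X (k + i) = eP (𝔖.partialSum s a t' p i) := fun i => by simp [X]
    refine ⟨X, ?_, ?_, ?_, ?_, hX' 0, ?_, ?_⟩
    · exact fun i hi => (conf_iff _).2 ⟨_, (hX i hi).symm⟩
    · exact fun i _ => (weight_iff _).2 ⟨_, (hX' i).symm⟩
    · intro i hi j hj h
      rw [hX i hi, hX j (hj.trans hi)] at h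
      have := hS h
      rw [ht' i hi, ht' j (hj.trans hi)] at this
      have := Fin.mk.inj (h1 this)
      omega
    · intro x hx
      obtain ⟨x, rfl⟩ := (conf_iff _).1 hx
      rw [hR, step, h2]
      constructor
      · rintro ⟨i, rfl⟩
        exact ⟨i, i.2, by rw [hX i i.2, ht' i i.2]⟩
      · rintro ⟨i, hi, h⟩
        rw [hX i hi, ht' i hi] at h
        exact ⟨_, hS h⟩
    · rw [hX' k]
      congr 1
      apply Subtype.ext
      rw [WTS.coe_partialSum, Finset.sum_range, h3]
      congr 1
      exact Finset.sum_congr rfl fun i _ => by rw [ht' i i.2]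
    · intro i hi
      refine ⟨_, (weight_iff _).2 ⟨𝔖.δ s a (t' i), rfl⟩, ?_, ?_⟩
      · rw [hX i hi, hδ]
      · rw [add_assoc, hX', hX', ha]
        rfl

/-- The encodings map onto the three languages, so quantifiers over words in a language are
quantifiers over the corresponding sort. -/
theorem Presents.bisimW_iff (h : c.Presents 𝔖 R) (n : ℕ) :
    BisimW n c ↔ 𝔖.IsBoundedBisimulation n R := by
  obtain ⟨eS, eA, eP, hS, hA, hP, hSr, hAr, hPr, hδ, ha, hR⟩ := h
  have hδ := deltaW_iff hS hA hP hδ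
  have ha := addW_iff hP ha
  have hR := relW_iff hS hR
  have hch := exists_chainW_iff hS hP hSr hPr hδ ha hR
  have hconf : ∀ P : List ℕ → Prop, (∀ x, x ∈ c.conf.language → P x) ↔ ∀ s, P (eS s) :=
    fun P => by rw [← hSr]; exact Set.forall_mem_range
  have hact : ∀ P : List ℕ → Prop, (∀ x, x ∈ c.act.language → P x) ↔ ∀ a, P (eA a) :=
    fun P => by rw [← hAr]; exact Set.forall_mem_range
  have hweight : ∀ P : List ℕ → Prop, (∃ x, x ∈ c.weight.language ∧ P x) ↔ ∃ p, P (eP p) :=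
    fun P => by rw [← hPr]; exact Set.exists_range_iff
  simp only [BisimW, hconf, hact, hweight, hR, hch]
  rfl

end Presentation

/-! ### Bisimulations under a branching bound -/

namespace WTS

variable {S A : Type*} {𝔖 : WTS S A} {R : S → S → Prop}

/-- Members of the class that are not enumerated have weight zero. -/
theorem tsum_eq_sum_of_enumerates {k : ℕ} {s : S} {a : A} {u : S} {t : Fin k → S}
    (ht : t.Injective) (hx : ∀ x, (R u x ∧ 𝔖.Step s a x ↔ ∃ i, t i = x)) {E : Set S}
    (hE : E = {x | R u x}) :
    ∑' x : E, ((𝔖.δ s a x : ℝ≥0) : ℝ≥0∞) = ((∑ i, (𝔖.δ s a (t i) : ℝ≥0) : ℝ≥0) : ℝ≥0∞) := by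
  have hmem : ∀ i, t i ∈ E := fun i => by rw [hE]; exact ((hx _).2 ⟨i, rfl⟩).1
  let t' : Fin k → E := fun i => ⟨t i, hmem i⟩
  have ht' : t'.Injective := fun i j h => ht (Subtype.mk.inj h)
  have hsup : (Function.support fun x : E => ((𝔖.δ s a x : ℝ≥0) : ℝ≥0∞)) ⊆ Set.range t' := by
    rintro ⟨x, hxE⟩ h
    rw [Function.mem_support, ne_eq, ENNReal.coe_eq_zero] at h
    obtain ⟨i, hi⟩ := (hx x).1 ⟨by rwa [hE] at hxE, h⟩
    exact ⟨i, Subtype.ext hi⟩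
  rw [← ht'.tsum_eq hsup, tsum_fintype, ENNReal.ofNNReal_finsetSum]

theorem BranchingBound.exists_enumeration {n : ℕ} (hb : 𝔖.BranchingBound n)
    (R : S → S → Prop) (s : S) (a : A) (u : S) :
    ∃ k < n + 1, ∃ t : Fin k → S, t.Injective ∧ ∀ x, (R u x ∧ 𝔖.Step s a x ↔ ∃ i, t i = x) := by
  have hle : {x | R u x ∧ 𝔖.Step s a x}.encard ≤ n :=
    (Set.encard_le_encard fun x hx => hx.2).trans (hb s a)
  have hfin : {x | R u x ∧ 𝔖.Step s a x}.Finite := Set.finite_of_encard_le_coe hle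
  have hcard : hfin.toFinset.card < n + 1 := by
    rw [hfin.encard_eq_coe_toFinset_card] at hle
    exact Nat.lt_succ_of_le (by exact_mod_cast hle)
  refine ⟨_, hcard, fun i => (hfin.toFinset.equivFin.symm i : S),
    Subtype.val_injective.comp (Equiv.injective _), fun x => ?_⟩
  constructor
  · intro hx
    exact ⟨hfin.toFinset.equivFin ⟨x, hfin.mem_toFinset.2 hx⟩, by simp⟩
  · rintro ⟨i, rfl⟩
    exact hfin.mem_toFinset.1 (hfin.toFinset.equivFin.symm i).2

theorem BranchingBound.isBisimulation_iff {n : ℕ} (hb : 𝔖.BranchingBound n) :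
    𝔖.IsBisimulation R ↔ 𝔖.IsBoundedBisimulation n R := by
  constructor
  · rintro ⟨h, hsum⟩
    refine ⟨h.refl, fun s t => h.symm, fun s t u => h.trans, fun s s' a u hss' => ?_⟩
    obtain ⟨k, hk, t, ht, hx⟩ := hb.exists_enumeration R s a u
    obtain ⟨l, hl, t', ht', hx'⟩ := hb.exists_enumeration R s' a u
    have hE : {x | R x u} = {x | R u x} := Set.ext fun x => ⟨h.symm, h.symm⟩
    have key := hsum s s' hss' a {x | R x u} ⟨u, rfl⟩
    rw [tsum_eq_sum_of_enumerates ht hx hE, tsum_eq_sum_of_enumerates ht' hx' hE,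
      ENNReal.coe_inj] at key
    -- Any weight would do as offset; `P` may lack `0`, but this one is at hand.
    let p := 𝔖.δ s a s
    let y : ℕ → S := fun i => if h : i < k then t ⟨i, h⟩ else s
    have hq : (𝔖.partialSum s a y p k : ℝ≥0) = p + ∑ i, (𝔖.δ s a (t i) : ℝ≥0) := by
      rw [coe_partialSum, Finset.sum_range]
      congr 1
      exact Finset.sum_congr rfl fun i _ => by simp [y]
    exact ⟨p, 𝔖.partialSum s a y p k, ⟨k, hk, t, ht, hx, hq⟩, l, hl, t', ht', hx', key ▸ hq⟩
  · rintro ⟨h1, h2, h3, hsum⟩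
    refine ⟨⟨h1, fun {s t} => h2 s t, fun {s t u} => h3 s t u⟩, ?_⟩
    rintro s s' hss' a E ⟨u, rfl⟩
    obtain ⟨p, q, ⟨k, _, t, ht, hx, hq⟩, l, _, t', ht', hx', hq'⟩ := hsum s s' a u hss'
    have hE : {x | R x u} = {x | R u x} := Set.ext fun x => ⟨h2 _ _, h2 _ _⟩
    have e := tsum_eq_sum_of_enumerates ht hx hE
    have e' := tsum_eq_sum_of_enumerates ht' hx' hE
    refine e.trans (Eq.trans ?_ e'.symm)
    rw [ENNReal.coe_inj]
    -- The common offset `p` cancels.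
    exact add_left_cancel (hq.symm.trans hq')

end WTS

/-! ### The sentences -/

namespace WTSFormula

variable {s a p : ℕ}

def neg (φ : WTSFormula s a p) : WTSFormula s a p := .imp φ .falsum

def conj (φ ψ : WTSFormula s a p) : WTSFormula s a p := neg (.imp φ (neg ψ))

def equiv (φ ψ : WTSFormula s a p) : WTSFormula s a p := conj (.imp φ ψ) (.imp ψ φ)

def bigConj (l : List (WTSFormula s a p)) : WTSFormula s a p := l.foldr conj (neg .falsum)

def bigDisj (l : List (WTSFormula s a p)) : WTSFormula s a p := neg (bigConj (l.map neg))

def exWeight (φ : WTSFormula s a (p + 1)) : WTSFormula s a p := neg (.allWeight (neg φ))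

/-- Existential quantification over `k` configurations. -/
def exConfs : (k : ℕ) → WTSFormula (s + k) a p → WTSFormula s a p
  | 0, φ => φ
  | k + 1, φ => exConfs k (neg (.allConf (neg φ)))

/-- `δ(i, k, j) ≠ 0`. -/
def step (i : Fin s) (k : Fin a) (j : Fin s) : WTSFormula s a p :=
  neg (.eqWeight (.add (.delta i k j) (.delta i k j)) (.delta i k j))

end WTSFormula

/-- The assignment that extends `v` by a block of `k` values. -/
def blockCons {S : Type*} {s k : ℕ} (t : Fin k → S) (v : Fin s → S) : Fin (s + k) → S :=
  fun i => if h : i < k then t ⟨i, h⟩ else v ⟨i - k, by omega⟩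

/-- The `i`-th variable of a block of `k` variables. -/
def blockVar {s k : ℕ} (i : Fin k) : Fin (s + k) := ⟨i, by omega⟩

theorem blockCons_blockVar {S : Type*} {s k : ℕ} (t : Fin k → S) (v : Fin s → S) (i : Fin k) :
    blockCons t v (blockVar i) = t i := by
  simp [blockCons, blockVar]

theorem blockCons_addNat {S : Type*} {s k : ℕ} (t : Fin k → S) (v : Fin s → S) (i : Fin s) :
    blockCons t v (i.addNat k) = v i := by
  simp [blockCons]

/-- The induction step for `exConfs`: the innermost quantifier puts its value at the front of the
block. -/
theorem cons_blockCons {S : Type*} {s k : ℕ} (x : S) (t : Fin k → S) (v : Fin s → S) :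
    (Fin.cons x (blockCons t v) : Fin (s + k + 1) → S) =
      blockCons (k := k + 1) (Fin.cons x t : Fin (k + 1) → S) v := by
  funext i
  refine Fin.cases ?_ (fun i => ?_) i
  · simp [blockCons]
  · by_cases h : (i : ℕ) < k
    · rw [Fin.cons_succ, blockCons, blockCons, dif_pos h,
        dif_pos (show (i.succ : ℕ) < k + 1 by simpa using h)]
      rfl
    · simp [blockCons, h]

namespace WTS

open WTSFormula

variable {S A : Type*} {𝔖 : WTS S A} {R : S → S → Prop} {s a p : ℕ}
  {vS : Fin s → S} {vA : Fin a → A} {vP : Fin p → 𝔖.P}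

theorem realize_neg {φ : WTSFormula s a p} :
    𝔖.Realize R (neg φ) vS vA vP ↔ ¬ 𝔖.Realize R φ vS vA vP := by
  simp only [neg, Realize]

theorem realize_conj {φ ψ : WTSFormula s a p} :
    𝔖.Realize R (conj φ ψ) vS vA vP ↔ 𝔖.Realize R φ vS vA vP ∧ 𝔖.Realize R ψ vS vA vP := by
  simp only [conj, realize_neg, Realize]
  tauto

theorem realize_equiv {φ ψ : WTSFormula s a p} :
    𝔖.Realize R (equiv φ ψ) vS vA vP ↔ (𝔖.Realize R φ vS vA vP ↔ 𝔖.Realize R ψ vS vA vP) := by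
  simp only [equiv, realize_conj, Realize]
  tauto

theorem realize_bigConj {l : List (WTSFormula s a p)} :
    𝔖.Realize R (bigConj l) vS vA vP ↔ ∀ φ ∈ l, 𝔖.Realize R φ vS vA vP := by
  induction l with
  | nil => simp [bigConj, realize_neg, Realize]
  | cons φ l ih =>
    rw [List.forall_mem_cons, ← ih]
    exact realize_conj

theorem realize_bigDisj {l : List (WTSFormula s a p)} :
    𝔖.Realize R (bigDisj l) vS vA vP ↔ ∃ φ ∈ l, 𝔖.Realize R φ vS vA vP := by
  simp [bigDisj, realize_neg, realize_bigConj]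

theorem realize_exWeight {φ : WTSFormula s a (p + 1)} :
    𝔖.Realize R (exWeight φ) vS vA vP ↔ ∃ x, 𝔖.Realize R φ vS vA (Fin.cons x vP) := by
  simp only [exWeight, realize_neg, Realize]
  push Not
  rfl

theorem realize_exConfs {k : ℕ} {φ : WTSFormula (s + k) a p} :
    𝔖.Realize R (exConfs k φ) vS vA vP ↔
      ∃ t : Fin k → S, 𝔖.Realize R φ (blockCons t vS) vA vP := by
  induction k with
  | zero =>
    have h : ∀ t : Fin 0 → S, blockCons t vS = vS := fun t => by
      funext i
      simp [blockCons]
    simp [exConfs, h]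
  | succ k ih =>
    rw [exConfs, ih]
    simp only [realize_neg, Realize]
    push Not
    simp only [cons_blockCons]
    exact ⟨fun ⟨t, x, h⟩ => ⟨_, h⟩, fun ⟨t, h⟩ => ⟨Fin.tail t, t 0, by rwa [Fin.cons_self_tail]⟩⟩

theorem realize_step {i : Fin s} {k : Fin a} {j : Fin s} :
    𝔖.Realize R (step i k j : WTSFormula s a p) vS vA vP ↔ 𝔖.Step (vS i) (vA k) (vS j) := by
  rw [step, realize_neg, step_iff]
  simp only [Realize, termValue, ne_eq]

end WTS

/-- The sum of the weight `x` and the weights of the transitions to the variables in a list. -/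
def WeightTerm.sum {s a p : ℕ} (x : WeightTerm s a p) (i : Fin s) (k : Fin a)
    (l : List (Fin s)) : WeightTerm s a p :=
  l.foldl (fun y j => .add y (.delta i k j)) x

theorem WTS.coe_termValue_sum {S A : Type*} {𝔖 : WTS S A} {s a p : ℕ} {vS : Fin s → S}
    {vA : Fin a → A} {vP : Fin p → 𝔖.P} {x : WeightTerm s a p} {i : Fin s} {k : Fin a}
    {l : List (Fin s)} :
    (𝔖.termValue vS vA vP (x.sum i k l) : ℝ≥0) =
      𝔖.termValue vS vA vP x + (l.map fun j => (𝔖.δ (vS i) (vA k) (vS j) : ℝ≥0)).sum := by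
  induction l generalizing x with
  | nil => simp [WeightTerm.sum]
  | cons j l ih =>
    rw [List.map_cons, List.sum_cons, ← add_assoc]
    exact ih

namespace WTSFormula

/-- The formula that expresses `WTS.SumIs`. -/
def sumIs {s a p : ℕ} (k : ℕ) (i : Fin s) (b : Fin a) (u : Fin s) (x y : Fin p) :
    WTSFormula s a p :=
  exConfs k <| conj
    (bigConj ((List.finRange k).flatMap fun m => (List.finRange k).map fun m' =>
      -- The case distinction is made while the formula is built: a diagonal pair imposes nothing,
      -- any other pair says that the two variables differ.
      .imp (.eqConf (blockVar m) (blockVar m')) (if m = m' then neg .falsum else .falsum))) <| conj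
    (.allConf (equiv (conj (.rel (u.addNat k).succ 0) (step (i.addNat k).succ b 0))
      (bigDisj ((List.finRange k).map fun m => .eqConf (blockVar m).succ 0))))
    (.eqWeight (.var y) (WeightTerm.sum (.var x) (i.addNat k) b
      ((List.finRange k).map blockVar)))

/-- The sentence that expresses `WTS.IsBoundedBisimulation n`. -/
def boundedBisim (n : ℕ) : WTSSentence :=
  conj (.allConf (.rel 0 0)) <| conj
    (.allConf (.allConf (.imp (.rel 1 0) (.rel 0 1)))) <| conj
    (.allConf (.allConf (.allConf (.imp (.rel 2 1) (.imp (.rel 1 0) (.rel 2 0)))))) <|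
    -- Indices count per sort: `s, s', u` become `2, 1, 0`, the action is `0`, and `p, q` become `1,
    -- 0`.
    .allConf <| .allConf <| .allAct <| .allConf <| .imp (.rel 2 1) <| exWeight <| exWeight <| conj
      (bigDisj ((List.range (n + 1)).map fun k => sumIs k 2 0 0 1 0))
      (bigDisj ((List.range (n + 1)).map fun k => sumIs k 1 0 0 1 0))

end WTSFormula

namespace WTS

open WTSFormula

variable {S A : Type*} {𝔖 : WTS S A} {R : S → S → Prop}

theorem realize_sumIs {s a p k : ℕ} {vS : Fin s → S} {vA : Fin a → A} {vP : Fin p → 𝔖.P}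
    {i u : Fin s} {b : Fin a} {x y : Fin p} :
    𝔖.Realize R (sumIs k i b u x y) vS vA vP ↔
      𝔖.SumIs R k (vS i) (vA b) (vS u) (vP x) (vP y) := by
  rw [sumIs, realize_exConfs, SumIs]
  refine exists_congr fun t => ?_
  rw [realize_conj, realize_conj]
  refine and_congr ?_ (and_congr ?_ ?_)
  · rw [realize_bigConj]
    simp only [List.mem_flatMap, List.mem_map, List.mem_finRange, true_and,
      forall_exists_index, Function.Injective]
    constructor
    · intro h m m' hm
      have := h _ m m' rfl
      simp only [Realize, blockCons_blockVar] at this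
      by_contra hne
      rw [if_neg hne] at this
      simpa only [Realize] using this hm
    · rintro h _ m m' rfl
      simp only [Realize, blockCons_blockVar]
      intro hm
      rw [if_pos (h hm), realize_neg]
      simp only [Realize, not_false_eq_true]
  · simp only [Realize]
    refine forall_congr' fun z => ?_
    rw [realize_equiv, realize_conj, realize_step, realize_bigDisj]
    simp [Realize, blockCons_addNat, blockCons_blockVar]
  · simp only [Realize]
    rw [← Subtype.coe_inj, coe_termValue_sum, List.map_map, Fin.sum_univ_def, blockCons_addNat]
    simp only [termValue, Function.comp_def, blockCons_blockVar]

theorem models_boundedBisim {n : ℕ} :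
    𝔖.Models R (boundedBisim n) ↔ 𝔖.IsBoundedBisimulation n R := by
  rw [Models, boundedBisim, IsBoundedBisimulation]
  simp only [realize_conj, Realize, realize_exWeight, realize_bigDisj, List.mem_map,
    List.mem_range, exists_exists_and_eq_and, realize_sumIs]
  rfl

end WTS

theorem mainTheorem1 :
    ∃ Φ : ℕ → WTSSentence,
      (∀ (n : ℕ) (S : Type*) (A : Type*) (𝔖 : WTS S A), 𝔖.BranchingBound n →
        ∀ R : S → S → Prop, 𝔖.IsBisimulation R ↔ 𝔖.Models R (Φ n)) ∧
      ∃ check : ℕ × Presentation → Bool, Computable check ∧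
        ∀ (n : ℕ) (S : Type*) (A : Type*) (𝔖 : WTS S A) (R : S → S → Prop) (c : Presentation),
          c.Presents 𝔖 R → (check (n, c) = true ↔ 𝔖.Models R (Φ n)) := by
  refine ⟨WTSFormula.boundedBisim, ?_, ?_⟩
  · intro n S A 𝔖 hb R
    rw [hb.isBisimulation_iff, WTS.models_boundedBisim]
  · classical
    -- For every presented system, the word test and the sentence are both equivalent to
    -- `IsBoundedBisimulation`; the branching bound matters only for the first claim.
    refine ⟨fun x => decide (Presentation.BisimW x.1 x.2),
      Presentation.primrecPred_bisimW.decide.to_comp, ?_⟩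
    intro n S A 𝔖 R c hc
    rw [decide_eq_true_iff, hc.bisimW_iff, WTS.models_boundedBisim]
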